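/- Let $\mathbb D$ be the open unit disk, $\mathbb D^*=\mathbb D\setminus\{0\}$ and $dA$ the normalized area measure on $\mathbb D$. Let $\alpha>-1$ and $-1<\beta\le 0$ be such that the function $Q_{\alpha,\beta}(\xi)={}_2F_1(\beta,-(\alpha+1);\beta+1;\xi)$ has no zero in $\mathbb D$. Put $$d\mu_{\alpha,\beta}(z)=\frac{1}{\mathscr B(\alpha+1,\beta+1)}|z|^{2\beta}(1-|z|^2)^\alpha\,dA(z),$$ where $\mathscr B$ is the beta function. For $1\le p<\infty$ let $\mathcal A^p_{\alpha,\beta}$ be the space of the holomorphic functions on $\mathbb D^*$ with $\|f\|_{\alpha,\beta,p}^p=\int_{\mathbb D}|f|^p\,d\mu_{\alpha,\beta}<\infty$ (functions with a removable singularity at $0$ are extended holomorphically to $0$), and let $$\mathbb K_{\alpha,\beta}(w,z)={}_2F_1(1,\alpha+\beta+2;\beta+1;w\overline z)=\frac{Q_{\alpha,\beta}(w\overline z)}{(1-w\overline z)^{\alpha+2}}$$ be the reproducing kernel of $\mathcal A^2_{\alpha,\beta}$, and $k^z(w)=\mathbb K_{\alpha,\beta}(w,z)/\|\mathbb K_{\alpha,\beta}(\cdot,z)\|_{\alpha,\beta,2}$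 the normalized kernel. For a positive Borel measure $\nu$ on $\mathbb D$ put $$T_\nu f(z)=\int_{\mathbb D}f(w)\,\overline{\mathbb K_{\alpha,\beta}(w,z)}\,d\nu(w),\qquad z\in\mathbb D,$$ where the integral is required to converge absolutely. Let $\langle f,g\rangle_{\alpha,\beta}=\int_{\mathbb D}f\overline g\,d\mu_{\alpha,\beta}$ and $\tilde\nu(z)=\langle T_\nu k^z,k^z\rangle_{\alpha,\beta}$, the Berezin transform. Call $\nu$ a vanishing Carleson measure on $\mathcal A^p_{\alpha,\beta}$ if the inclusion map $i_p:\mathcal A^p_{\alpha,\beta}\to L^p(\mathbb D,d\nu)$ is well defined (in particular, no function of the space has a pole at $0$ if $\nu(\{0\})\ne0$) and * if $p>1$, $i_p$ is compact; * if $p=1$, $\|i_1(f_n)\|_{L^1(d\nu)}\to0$ for every sequence $(f_n)$ in $\mathcal A^1_{\alpha,\beta}$ that converges to $0$ in the weak-star topology, that is, $\int_{\mathbb D}f_n\,g\,d\mu_{\alpha,\beta}\to0$ for every $g\in C_0(\mathbb D)$. **Theorem.** Let $1\le p<\infty$ and let $\nu$ be a positive Borel measure on $\mathbb D$. 1. If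 $\nu$ is a vanishing Carleson measure on $\mathcal A^p_{\alpha,\beta}$, then $T_\nu$ is well defined and compact on $\mathcal A^2_{\alpha,\beta}$. 2. If $T_\nu$ is well defined and compact on $\mathcal A^2_{\alpha,\beta}$, then $\tilde\nu(z)=\int_{\mathbb D}|k^z(w)|^2\,d\nu(w)$ for all $z\in\mathbb D$, and $\tilde\nu(z)\to0$ as $|z|\to1^-$. In particular, if $\nu$ is a vanishing Carleson measure on $\mathcal A^p_{\alpha,\beta}$, then $\tilde\nu(z)\to 0$ as $|z|\to1^-$. -/

import Mathlib

open MeasureTheory Filter Topology Metric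
open scoped ENNReal ComplexConjugate

noncomputable section

namespace ModifiedBergman

/-- The density of `μ_{α,β}` with respect to Lebesgue measure on the unit disk:
`|z|^{2β} (1 - |z|²)^α / (π B(α+1, β+1))`. The factor `1/π` normalizes the area measure. -/
def density (α β : ℝ) (z : ℂ) : ℝ :=
  ‖z‖ ^ (2 * β) * (1 - ‖z‖ ^ 2) ^ α / (Real.pi * ProbabilityTheory.beta (α + 1) (β + 1))

/-- The measure `μ_{α,β}`, as a measure on `ℂ` carried by the open unit disk. -/
def measure (α β : ℝ) : Measure ℂ :=
  (volume.restrict (ball (0 : ℂ) 1)).withDensity fun z => ENNReal.ofReal (density α β z)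

/-- The `β`-modified Bergman space `𝒜^p_{α,β}`: the classes in `L^p(μ_{α,β})` that contain a
function holomorphic on the punctured unit disk. It carries the norm of `L^p(μ_{α,β})`, and for
`p = 2` the inner product of `L²(μ_{α,β})`. -/
def Space (α β : ℝ) (p : ℝ≥0∞) : Submodule ℂ (Lp ℂ p (measure α β)) where
  carrier := {f | ∃ F : ℂ → ℂ, DifferentiableOn ℂ F (ball (0 : ℂ) 1 \ {0}) ∧
    f =ᵐ[measure α β] F}
  add_mem' := by
    rintro f g ⟨F, hF, hfF⟩ ⟨G, hG, hgG⟩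
    exact ⟨F + G, hF.add hG, (Lp.coeFn_add f g).trans (hfF.add hgG)⟩
  zero_mem' := ⟨0, differentiableOn_const 0, Lp.coeFn_zero ℂ p (measure α β)⟩
  smul_mem' := by
    rintro c f ⟨F, hF, hfF⟩
    exact ⟨c • F, hF.const_smul c, (Lp.coeFn_smul c f).trans (hfF.const_smul c)⟩

/-- The function `f` itself: the holomorphic representative on the punctured disk, extended to
the origin by its limit there when the singularity is removable.
(The value at a pole, and the values off the disk, are irrelevant.) -/
def holo {α β : ℝ} {p : ℝ≥0∞} (f : Space α β p) : ℂ → ℂ :=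
  Function.update (Classical.choose f.2) 0 (limUnder (𝓝[≠] 0) (Classical.choose f.2))

/-- The reproducing kernel `K_{α,β}(w,z) = ₂F₁(1, α+β+2; β+1; w z̄)` of `𝒜²_{α,β}`,
for `-1 < β ≤ 0`. -/
def kernel (α β : ℝ) (w z : ℂ) : ℂ :=
  ordinaryHypergeometric (1 : ℂ) ((α : ℂ) + β + 2) ((β : ℂ) + 1) (w * conj z)

/-- The numerator `Q_{α,β}(ξ) = ₂F₁(β, -(α+1); β+1; ξ)` in
`K_{α,β}(w,z) = Q_{α,β}(w z̄) / (1 - w z̄)^{α+2}`, for `-1 < β ≤ 0`. -/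
def numerator (α β : ℝ) (ξ : ℂ) : ℂ :=
  ordinaryHypergeometric (β : ℂ) (-((α : ℂ) + 1)) ((β : ℂ) + 1) ξ

/-- The set `𝒥_α` of all `β ∈ ]-1, 0]` such that `Q_{α,β}` has no zero in the unit disk. -/
def admissible (α : ℝ) : Set ℝ :=
  {β | -1 < β ∧ β ≤ 0 ∧ ∀ ξ ∈ ball (0 : ℂ) 1, numerator α β ξ ≠ 0}

/-- `i` is the inclusion `f ↦ f` of `𝒜^p_{α,β}` in `L^p(ν)`. For this to make sense every `f` has
to have a value at `ν`-almost every point, which excludes a pole at the origin if `ν {0} ≠ 0`. -/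
def IsInclusion {α β : ℝ} {p : ℝ≥0∞} {ν : Measure ℂ} (i : Space α β p →ₗ[ℂ] Lp ℂ p ν) : Prop :=
  ∀ f : Space α β p, (∀ᵐ z ∂ν, AnalyticAt ℂ (holo f) z) ∧ i f =ᵐ[ν] holo f

/-- The sequence `f n` tends to `0` in the weak-star topology of `𝒜¹_{α,β}`, that is, the topology
induced by `L¹(μ_{α,β}) ⊆ M(𝔻) = C₀(𝔻)*`. The functions `g` below are the elements of `C₀(𝔻)`,
extended by `0`. -/
def WeakStarNull {α β : ℝ} {p : ℝ≥0∞} (f : ℕ → Space α β p) : Prop :=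
  ∀ g : ℂ → ℂ, Continuous g → (∀ z, 1 ≤ ‖z‖ → g z = 0) →
    Tendsto (fun n => ∫ z, holo (f n) z * g z ∂(measure α β)) atTop (𝓝 0)

/-- `ν` is a vanishing Carleson measure on `𝒜^p_{α,β}`: the inclusion in `L^p(ν)` is defined and
is compact if `p > 1`; if `p = 1` it maps weak-star null sequences to norm null sequences. -/
def IsVanishingCarleson (α β : ℝ) (p : ℝ≥0∞) [Fact (1 ≤ p)] (ν : Measure ℂ) : Prop :=
  ∃ i : Space α β p →ₗ[ℂ] Lp ℂ p ν, IsInclusion i ∧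
    (1 < p → IsCompactOperator i) ∧
    (p = 1 → ∀ f : ℕ → Space α β p, WeakStarNull f →
      Tendsto (fun n => ‖i (f n)‖) atTop (𝓝 0))

/-- `T_ν F (z) = ∫ F(w) conj (K_{α,β}(w,z)) dν(w)`. -/
def toeplitz (α β : ℝ) (ν : Measure ℂ) (F : ℂ → ℂ) (z : ℂ) : ℂ :=
  ∫ w, F w * conj (kernel α β w z) ∂ν

/-- `T` is the Toeplitz operator `T_ν` on `𝒜²_{α,β}`; the integral defining `T_ν f (z)` has to
converge absolutely for all `f` in the space and all `z` in the disk. -/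
def IsToeplitz {α β : ℝ} (ν : Measure ℂ) (T : Space α β 2 →L[ℂ] Space α β 2) : Prop :=
  ∀ f : Space α β 2, ∀ z ∈ ball (0 : ℂ) 1,
    Integrable (fun w => holo f w * conj (kernel α β w z)) ν ∧
      holo (T f) z = toeplitz α β ν (holo f) z

/-- `T_ν` is (well defined and) compact on `𝒜²_{α,β}`. -/
def ToeplitzCompact (α β : ℝ) (ν : Measure ℂ) : Prop :=
  ∃ T : Space α β 2 →L[ℂ] Space α β 2, IsToeplitz ν T ∧ IsCompactOperator T

/-- The normalized reproducing kernel `k^z(w) = K_{α,β}(w,z) / ‖K_{α,β}(·,z)‖_{α,β,2}`. -/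
def normalizedKernel (α β : ℝ) (z w : ℂ) : ℂ :=
  kernel α β w z / (√(∫ u, ‖kernel α β u z‖ ^ 2 ∂(measure α β)) : ℝ)

/-- The Berezin transform `ν̃(z) = ⟨T_ν k^z, k^z⟩_{α,β}`. -/
def berezin (α β : ℝ) (ν : Measure ℂ) (z : ℂ) : ℂ :=
  ∫ u, toeplitz α β ν (normalizedKernel α β z) u * conj (normalizedKernel α β z u)
    ∂(measure α β)

end ModifiedBergman

end

/-! Everything passes through one condition that does not involve `p`: ν(ball u ((1-|u|)/3)) =
o((1-|u|²)^{α+2}) as |u| → 1.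

A vanishing Carleson measure satisfies it, by testing on (1-|u|²)^{N-(α+2)/p} (1-ūw)^{-N}. A
Forelli–Rudin estimate bounds these functions in 𝒜^p. As |u| → 1 they tend to 0 locally uniformly,
while their size near u is at least a multiple of (1-|u|²)^{-(α+2)/p}. Compactness of the inclusion
(weak-star nullity if p = 1) sends their L^p(ν) norms to 0, and Chebyshev's inequality gives the
condition (`measure_ball_le`, `IsVanishingCarleson.exists_radius`).

Conversely, the condition, the area mean value inequality for F² and Tonelli's theorem make ∫|F|² dν
over a thin boundary annulus at most ε‖F‖² (`lintegral_annulus_le`). Since ν is finite, the rest is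
controlled by the supremum of |F| on a compact disk. Hence the inclusion ι of 𝒜² in L²(ν) is
bounded, and it is a norm limit of finite rank operators, because functions orthogonal to 1, z, ...,
z^{N-1} are small on compact disks (`SmallEmbedding.isCompactOperator`). Finally T_ν = ι†ι is
compact.

For the Berezin transform: the Taylor coefficients of the kernel are the reciprocals of the moments
of μ, so the kernel reproduces (`inner_kernelAt`), which turns ⟨T_ν k^z, k^z⟩ into ∫|k^z|² dν. The
moments are at most 1, so ‖K_z‖² ≥ 1/(1-|z|²) and k^z is weakly null at the boundary. A compact T_ν
sends it to a norm null family, and |⟨T_ν k^z, k^z⟩| ≤ ‖T_ν k^z‖.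

The sign of β enters through |z|^{2β} ≥ 1, which bounds the weight from below and removes
singularities at 0, and through the comparison of coefficients in `ascPochhammer_mul_moment_le`. -/

namespace ModifiedBergman

/-! ### Rotation invariance, mean values and Taylor coefficients -/

/-- A measure on `ℂ` that is invariant under all rotations about the origin. -/
def RotationInvariant (μ : Measure ℂ) : Prop :=
  ∀ c : ℂ, ‖c‖ = 1 → MeasurePreserving (fun z => c * z) μ μ

lemma rotationInvariant_volume : RotationInvariant volume := by
  intro c hc
  exact (rotation ⟨c, mem_sphere_zero_iff_norm.2 hc⟩).measurePreserving

lemma RotationInvariant.withDensity {μ : Measure ℂ} (h : RotationInvariant μ) {φ : ℂ → ℝ≥0∞}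
    (hφ : Measurable φ) (hr : ∀ c z : ℂ, ‖c‖ = 1 → φ (c * z) = φ z) :
    RotationInvariant (μ.withDensity φ) := by
  intro c hc
  refine ⟨(h c hc).measurable, ?_⟩
  ext s hs
  rw [Measure.map_apply (h c hc).measurable hs, withDensity_apply _ hs,
    withDensity_apply _ ((h c hc).measurable hs),
    ← (h c hc).setLIntegral_comp_preimage hs hφ]
  exact lintegral_congr fun z => (hr c z hc).symm

lemma RotationInvariant.restrict_ball {μ : Measure ℂ} (h : RotationInvariant μ) (R : ℝ) :
    RotationInvariant (μ.restrict (ball 0 R)) := by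
  intro c hc
  have := (h c hc).restrict_preimage (s := ball (0 : ℂ) R) measurableSet_ball
  convert this using 2
  ext z
  simp [hc]

/-- Averaging over the circles about the origin does not change the integral. -/
lemma RotationInvariant.integral_eq_integral_circleAverage {μ : Measure ℂ} [SFinite μ]
    (h : RotationInvariant μ) {g : ℂ → ℂ} (hg : Integrable g μ) :
    ∫ w, g w ∂μ = ∫ w, Real.circleAverage g 0 ‖w‖ ∂μ := by
  set I : Measure ℝ := volume.restrict (Set.Ioc 0 (2 * Real.pi)) with hI
  -- The shear (θ, w) ↦ (θ, e^{iθ}w) preserves the product measure, so Fubini may exchange the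
  -- average over θ with the integral over w.
  have hΦ : MeasurePreserving
      (fun p : ℝ × ℂ => (id p.1, Complex.exp (p.1 * Complex.I) * p.2)) (I.prod μ) (I.prod μ) := by
    refine (MeasurePreserving.id I).skew_product (g := fun θ z => Complex.exp (θ * Complex.I) * z)
      ?_ ?_
    · exact (by fun_prop : Continuous fun p : ℝ × ℂ =>
        Complex.exp (p.1 * Complex.I) * p.2).measurable
    · exact Eventually.of_forall fun θ => (h _ (Complex.norm_exp_ofReal_mul_I θ)).map_eq
  have hg2 : Integrable (fun p : ℝ × ℂ => g p.2) (I.prod μ) := hg.comp_snd I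
  have hint : Integrable (fun p : ℝ × ℂ => g (Complex.exp (p.1 * Complex.I) * p.2))
      (I.prod μ) := (hΦ.integrable_comp hg2.aestronglyMeasurable).2 hg2
  have hswap := integral_integral_swap
    (f := fun (θ : ℝ) (w : ℂ) => g (Complex.exp (θ * Complex.I) * w)) hint
  have h1 : ∀ θ : ℝ, ∫ w, g (Complex.exp (θ * Complex.I) * w) ∂μ = ∫ w, g w ∂μ := by
    intro θ
    have hc := Complex.norm_exp_ofReal_mul_I θ
    refine (h _ hc).integral_comp ?_ g
    exact (Homeomorph.mulLeft₀ (Complex.exp (θ * Complex.I))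
      (Complex.exp_ne_zero _)).measurableEmbedding
  have h2 : ∀ w : ℂ, ∫ θ, g (Complex.exp (θ * Complex.I) * w) ∂I
      = (2 * Real.pi) • Real.circleAverage g 0 ‖w‖ := by
    intro w
    -- The orbit of w starts at the angle arg w and not at 0; by periodicity the average may start
    -- there as well.
    rw [Real.circleAverage_eq_integral_add (Complex.arg w), smul_smul,
      mul_inv_cancel₀ (by positivity), one_smul,
      intervalIntegral.integral_of_le (by positivity)]
    refine integral_congr_ae (Eventually.of_forall fun θ => ?_)
    simp only [circleMap, zero_add]
    congr 1
    push_cast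
    rw [add_mul, Complex.exp_add]
    conv_lhs => rw [← Complex.norm_mul_exp_arg_mul_I w]
    ring
  simp_rw [h1, h2] at hswap
  rw [integral_smul] at hswap
  have hvol : I.real Set.univ = 2 * Real.pi := by
    simp [hI, Measure.real, Real.pi_pos.le]
  rw [integral_const, hvol] at hswap
  exact smul_right_injective ℂ (by positivity : (2 * Real.pi) ≠ 0) hswap

/-- Area mean value inequality. -/
lemma area_mul_norm_le_setIntegral {H : ℂ → ℂ} {w : ℂ} {R : ℝ} (hR : 0 < R)
    (hH : DifferentiableOn ℂ H (ball w R)) (hi : IntegrableOn H (ball w R)) :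
    Real.pi * R ^ 2 * ‖H w‖ ≤ ∫ u in ball w R, ‖H u‖ := by
  have hpre : (fun u => w + u) ⁻¹' ball w R = ball (0 : ℂ) R := by ext u; simp
  have hmp : MeasurePreserving (fun u => w + u) (volume.restrict (ball (0 : ℂ) R))
      (volume.restrict (ball w R)) := by
    have := (measurePreserving_add_left (volume : Measure ℂ) w).restrict_preimage
      (s := ball w R) measurableSet_ball
    rwa [hpre] at this
  have hemb : MeasurableEmbedding (fun u : ℂ => w + u) := (Homeomorph.addLeft w).measurableEmbedding
  have hi' : Integrable (fun u => H (w + u)) (volume.restrict (ball (0 : ℂ) R)) :=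
    (hmp.integrable_comp hi.aestronglyMeasurable).2 hi
  have key := (rotationInvariant_volume.restrict_ball R).integral_eq_integral_circleAverage hi'
  have hd : DifferentiableOn ℂ (fun u => H (w + u)) (ball 0 R) := by
    refine hH.comp (by fun_prop) fun u hu => ?_
    simpa using hu
  have hav : ∀ u ∈ ball (0 : ℂ) R,
      Real.circleAverage (fun u => H (w + u)) 0 ‖u‖ = H w := by
    intro u hu
    have hu' : ‖u‖ < R := by simpa using hu
    have : DiffContOnCl ℂ (fun u => H (w + u)) (ball 0 |‖u‖|) := by
      refine DifferentiableOn.diffContOnCl (hd.mono ?_)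
      rw [abs_norm]
      exact closure_ball_subset_closedBall.trans (closedBall_subset_ball hu')
    rw [this.circleAverage]
    simp
  rw [setIntegral_congr_fun measurableSet_ball hav, setIntegral_const] at key
  have hvol : (volume : Measure ℂ).real (ball 0 R) = Real.pi * R ^ 2 := by
    rw [Measure.real, Complex.volume_ball]
    simp [hR.le, ENNReal.toReal_ofReal]
    ring
  rw [hvol] at key
  calc Real.pi * R ^ 2 * ‖H w‖ = ‖(Real.pi * R ^ 2) • H w‖ := by
        rw [norm_smul, Real.norm_of_nonneg (by positivity)]
    _ = ‖∫ u in ball (0 : ℂ) R, H (w + u)‖ := by rw [key]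
    _ ≤ ∫ u in ball (0 : ℂ) R, ‖H (w + u)‖ := norm_integral_le_integral_norm _
    _ = ∫ u in ball w R, ‖H u‖ := hmp.integral_comp hemb (fun u => ‖H u‖)

/-- Area mean value inequality for `|F|²`, as an inequality of lower integrals. -/
lemma ofReal_norm_sq_le_lintegral {F : ℂ → ℂ} {w : ℂ} {R : ℝ} (hR : 0 < R)
    (hF : DifferentiableOn ℂ F (ball w R)) :
    ENNReal.ofReal (Real.pi * R ^ 2) * ENNReal.ofReal (‖F w‖ ^ 2) ≤
      ∫⁻ u in ball w R, ENNReal.ofReal (‖F u‖ ^ 2) := by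
  have hF2 : DifferentiableOn ℂ (fun u => F u ^ 2) (ball w R) := hF.pow 2
  have hm : AEStronglyMeasurable (fun u => F u ^ 2) (volume.restrict (ball w R)) :=
    hF2.continuousOn.aestronglyMeasurable measurableSet_ball
  by_cases hi : IntegrableOn (fun u => F u ^ 2) (ball w R)
  · have := area_mul_norm_le_setIntegral hR hF2 hi
    rw [← ENNReal.ofReal_mul (by positivity)]
    simp only [norm_pow] at this
    have h3 := hi.norm
    simp only [norm_pow] at h3
    rw [← ofReal_integral_eq_lintegral_ofReal h3 (Eventually.of_forall fun _ => by positivity)]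
    exact ENNReal.ofReal_le_ofReal this
  -- Without integrability the Bochner inequality says nothing, but then the right-hand side is
  -- infinite.
  · have : ∫⁻ u in ball w R, ENNReal.ofReal (‖F u‖ ^ 2) = ∞ := by
      by_contra hne
      refine hi ⟨hm, ?_⟩
      rw [hasFiniteIntegral_iff_norm]
      simpa [norm_pow] using lt_top_iff_ne_top.2 hne
    rw [this]
    exact le_top

/-- The Taylor expansion on the unit disk, with the coefficients as circle averages. -/
lemma exists_coeff_hasSum_circleAverage {G : ℂ → ℂ} (hG : DifferentiableOn ℂ G (ball 0 1)) :
    ∃ c : ℕ → ℂ, (∀ z ∈ ball (0 : ℂ) 1, HasSum (fun n => c n * z ^ n) (G z)) ∧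
      ∀ (n : ℕ) (r : ℝ), 0 < r → r < 1 →
        Real.circleAverage (fun w => G w * conj w ^ n) 0 r = c n * (r : ℂ) ^ (2 * n) := by
  have hps : ∀ r : NNReal, 0 < r → r < 1 →
      HasFPowerSeriesOnBall G (cauchyPowerSeries G 0 r) 0 r := fun r h0 h1 =>
    (hG.mono (closedBall_subset_ball (by exact_mod_cast h1))).hasFPowerSeriesOnBall h0
  have hhalf : (0 : NNReal) < 1 / 2 := by norm_num
  have hhalf1 : (1 / 2 : NNReal) < 1 := by
    rw [← NNReal.coe_lt_coe]; norm_num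
  set p := cauchyPowerSeries G 0 ((1 / 2 : NNReal) : ℝ) with hp
  -- By uniqueness of power series the Cauchy coefficients do not depend on the radius of the
  -- circle.
  have heq : ∀ r : NNReal, 0 < r → r < 1 → cauchyPowerSeries G 0 r = p := fun r h0 h1 =>
    (hps r h0 h1).hasFPowerSeriesAt.eq_formalMultilinearSeries
      (hps _ hhalf hhalf1).hasFPowerSeriesAt
  refine ⟨fun n => p n fun _ => 1, ?_, ?_⟩
  · intro z hz
    have hz' : ‖z‖ < 1 := by simpa using hz
    obtain ⟨r, hr1, hr2⟩ := exists_between hz'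
    have hr0 : 0 < r := (norm_nonneg z).trans_lt hr1
    lift r to NNReal using hr0.le
    have := (hps r (by exact_mod_cast hr0) (by exact_mod_cast hr2)).hasSum (y := z) (by
      rw [mem_eball, edist_zero_right, enorm_eq_nnnorm, ENNReal.coe_lt_coe]
      exact_mod_cast hr1)
    rw [heq r (by exact_mod_cast hr0) (by exact_mod_cast hr2), zero_add] at this
    have hfun : (fun n => (p n fun _ => 1) * z ^ n) = fun n => p n fun _ => z := by
      funext n
      have h1 := (p n).map_smul_univ (fun _ => z) (fun _ => 1)
      simp only [smul_eq_mul, mul_one, Finset.prod_const, Finset.card_univ, Fintype.card_fin] at h1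
      rw [h1, mul_comm]
    rw [hfun]
    exact this
  · intro n r hr0 hr1
    lift r to NNReal using hr0.le
    have h1 := heq r (by exact_mod_cast hr0) (by exact_mod_cast hr1)
    simp only [← h1]
    rw [cauchyPowerSeries_apply]
    -- On |w| = r one has w̄ = r²/w, which turns the average into Cauchy's integral for the n-th
    -- coefficient.
    have hsub : Set.EqOn (fun w => G w * conj w ^ n)
        (fun w => ((r : ℂ) ^ (2 * n)) • ((1 / w) ^ n * G w)) (sphere 0 |r|) := by
      intro w hw
      have hw' : ‖w‖ = r := by simpa [abs_of_pos hr0] using hw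
      have hw0 : w ≠ 0 := by rw [← norm_pos_iff, hw']; exact hr0
      have hcw : conj w = (r : ℂ) ^ 2 * (1 / w) := by
        rw [mul_one_div, eq_div_iff hw0, mul_comm, Complex.mul_conj, Complex.normSq_eq_norm_sq,
          hw']
        push_cast; rfl
      simp only [hcw, smul_eq_mul]
      ring
    rw [Real.circleAverage_congr_sphere hsub, Real.circleAverage_fun_smul, smul_eq_mul, mul_comm]
    congr 1
    rw [Real.circleAverage_eq_circleIntegral hr0.ne']
    simp only [smul_eq_mul, sub_zero]
    congr 1
    refine circleIntegral.integral_congr hr0.le fun w hw => ?_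
    ring

/-- The circle averages of `|1 - ā w|⁻²`. -/
lemma circleAverage_norm_one_sub_mul_rpow {a : ℂ} {r : ℝ} (ha : ‖a‖ < 1) (hr : 0 ≤ r)
    (hr1 : r < 1) :
    Real.circleAverage (fun w => (((‖1 - conj a * w‖ ^ 2)⁻¹ : ℝ) : ℂ)) 0 r
      = (((1 - ‖a‖ ^ 2 * r ^ 2)⁻¹ : ℝ) : ℂ) := by
  rcases hr.eq_or_lt with rfl | hr0
  · simp
  have hne : ∀ w : ℂ, ‖w‖ ≤ r → 1 - conj a * w ≠ 0 := by
    intro w hw h0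
    have : ‖conj a * w‖ = 1 := by rw [← sub_eq_zero.1 h0]; simp
    rw [norm_mul, RCLike.norm_conj] at this
    nlinarith [norm_nonneg a, norm_nonneg w]
  have hdiff : DiffContOnCl ℂ (fun w : ℂ => (1 - conj a * w)⁻¹) (ball 0 |r|) := by
    refine DifferentiableOn.diffContOnCl fun w hw => ?_
    have hw' : ‖w‖ ≤ r := by
      simpa [abs_of_pos hr0] using closure_ball_subset_closedBall hw
    exact ((by fun_prop : DifferentiableAt ℂ (fun w : ℂ => 1 - conj a * w) w).inv
      (hne w hw')).differentiableWithinAt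
  -- On |w| = r one has r² = w w̄, so w/(w - ar²) = 1/(1 - a w̄). The average is therefore Cauchy's
  -- formula for 1/(1 - āw) at the point ar².
  have hmem : a * (r : ℂ) ^ 2 ∈ ball (0 : ℂ) |r| := by
    rw [mem_ball_zero_iff, norm_mul, norm_pow, Complex.norm_real, Real.norm_eq_abs, abs_of_pos hr0]
    nlinarith [mul_pos hr0 hr0, norm_nonneg a]
  have := hdiff.circleAverage_smul_div hmem
  rw [show (((1 - ‖a‖ ^ 2 * r ^ 2)⁻¹ : ℝ) : ℂ) = (1 - conj a * (a * (r : ℂ) ^ 2))⁻¹ by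
    push_cast
    rw [← mul_assoc, mul_comm (conj a) a, Complex.mul_conj, Complex.normSq_eq_norm_sq]
    push_cast; rfl, ← this]
  refine Real.circleAverage_congr_sphere fun w hw => ?_
  have hw' : ‖w‖ = r := by simpa [abs_of_pos hr0] using hw
  have hw0 : w ≠ 0 := by rw [← norm_pos_iff, hw']; exact hr0
  have hwr : (r : ℂ) ^ 2 = w * conj w := by
    rw [Complex.mul_conj, Complex.normSq_eq_norm_sq, hw']; push_cast; rfl
  have h1 := hne w hw'.le
  have h2 : 1 - a * conj w ≠ 0 := by
    intro h0
    apply h1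
    have := congrArg conj h0
    simpa using this
  have h3 : w - a * (w * conj w) = w * (1 - a * conj w) := by ring
  simp only [sub_zero, smul_eq_mul, hwr]
  rw [h3]
  have h4 : (((‖1 - conj a * w‖ ^ 2)⁻¹ : ℝ) : ℂ) = ((1 - conj a * w) * (1 - a * conj w))⁻¹ := by
    push_cast
    rw [← Complex.ofReal_pow, ← Complex.normSq_eq_norm_sq, ← Complex.mul_conj]
    simp
  rw [h4]
  field_simp

/-! ### The measure -/

lemma measurable_density (α β : ℝ) : Measurable (density α β) := by
  unfold density; fun_prop

lemma density_nonneg {α β : ℝ} (hα : -1 < α) (hβ : -1 < β) {z : ℂ} (hz : ‖z‖ < 1) :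
    0 ≤ density α β z := by
  have h1 : 0 < 1 - ‖z‖ ^ 2 := by nlinarith [norm_nonneg z]
  have := ProbabilityTheory.beta_pos (α := α + 1) (β := β + 1) (by linarith) (by linarith)
  unfold density
  positivity

lemma measurable_ofReal_density (α β : ℝ) :
    Measurable fun z => ENNReal.ofReal (density α β z) :=
  (measurable_density α β).ennreal_ofReal

lemma rotationInvariant_measure (α β : ℝ) : RotationInvariant (measure α β) :=
  (rotationInvariant_volume.restrict_ball 1).withDensity (measurable_ofReal_density α β)
    fun c z hc => by simp [density, hc]

lemma ae_mem_ball (α β : ℝ) : ∀ᵐ z ∂measure α β, z ∈ ball (0 : ℂ) 1 :=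
  (withDensity_absolutelyContinuous _ _).ae_le (ae_restrict_mem measurableSet_ball)

lemma ae_ne_zero (α β : ℝ) : ∀ᵐ z ∂measure α β, z ≠ 0 :=
  (withDensity_absolutelyContinuous _ _).ae_le
    (ae_restrict_of_ae (Measure.ae_ne volume (0 : ℂ)))

lemma integrable_measure_iff {α β : ℝ} (hα : -1 < α) (hβ : -1 < β) {E : Type*}
    [NormedAddCommGroup E] [NormedSpace ℝ E] {g : ℂ → E} :
    Integrable g (measure α β) ↔ IntegrableOn (fun z => density α β z • g z) (ball 0 1) := by
  rw [measure, integrable_withDensity_iff_integrable_smul' (measurable_ofReal_density α β)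
    (Eventually.of_forall fun _ => ENNReal.ofReal_lt_top)]
  refine integrable_congr ((ae_restrict_iff' measurableSet_ball).2 (Eventually.of_forall ?_))
  intro z hz
  simp only [ENNReal.toReal_ofReal (density_nonneg hα hβ (mem_ball_zero_iff.1 hz))]

lemma integral_measure {α β : ℝ} (hα : -1 < α) (hβ : -1 < β) {E : Type*}
    [NormedAddCommGroup E] [NormedSpace ℝ E] (g : ℂ → E) :
    ∫ z, g z ∂measure α β = ∫ z in ball (0 : ℂ) 1, density α β z • g z := by
  rw [measure, integral_withDensity_eq_integral_toReal_smul (measurable_ofReal_density α β)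
    (Eventually.of_forall fun _ => ENNReal.ofReal_lt_top)]
  refine setIntegral_congr_fun measurableSet_ball ?_
  intro z hz
  simp only [ENNReal.toReal_ofReal (density_nonneg hα hβ (mem_ball_zero_iff.1 hz))]

/-- The moments `∫ |z|^{2n} dμ_{α,β}`, in closed form. -/
noncomputable def moment (α β : ℝ) (n : ℕ) : ℝ :=
  (ascPochhammer ℝ n).eval (β + 1) / (ascPochhammer ℝ n).eval (α + β + 2)

lemma moment_pos {α β : ℝ} (hα : -1 < α) (hβ : -1 < β) (n : ℕ) : 0 < moment α β n :=
  div_pos (ascPochhammer_pos n _ (by linarith)) (ascPochhammer_pos n _ (by linarith))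

lemma Gamma_add_nat {x : ℝ} (hx : 0 < x) (n : ℕ) :
    Real.Gamma (x + n) = (ascPochhammer ℝ n).eval x * Real.Gamma x := by
  induction n with
  | zero => simp
  | succ n ih =>
    rw [ascPochhammer_succ_eval, Nat.cast_succ, ← add_assoc, Real.Gamma_add_one (by positivity), ih]
    ring

lemma beta_div_beta {α β : ℝ} (hα : -1 < α) (hβ : -1 < β) (n : ℕ) :
    ProbabilityTheory.beta (β + 1 + n) (α + 1) / ProbabilityTheory.beta (α + 1) (β + 1)
      = moment α β n := by
  have h1 := Real.Gamma_pos_of_pos (show 0 < α + 1 by linarith)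
  have h2 := Real.Gamma_pos_of_pos (show 0 < β + 1 by linarith)
  have h3 := Real.Gamma_pos_of_pos (show 0 < α + β + 2 by linarith)
  have h4 := ascPochhammer_pos n (α + β + 2) (by linarith)
  rw [ProbabilityTheory.beta, ProbabilityTheory.beta, Gamma_add_nat (by linarith),
    show β + 1 + n + (α + 1) = α + β + 2 + n by ring, Gamma_add_nat (by linarith),
    show α + 1 + (β + 1) = α + β + 2 by ring, moment]
  field_simp

/-- Polar coordinates and the substitution x = |z|² turn the integrand into a multiple of a beta
density, whose total mass is 1; integrability and the value both follow. -/
lemma integrable_and_integral_norm_pow {α β : ℝ} (hα : -1 < α) (hβ : -1 < β) (n : ℕ) :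
    Integrable (fun z => ‖z‖ ^ (2 * n)) (measure α β) ∧
      ∫ z, ‖z‖ ^ (2 * n) ∂measure α β = moment α β n := by
  set B := ProbabilityTheory.beta (α + 1) (β + 1) with hB
  set B' := ProbabilityTheory.beta (β + 1 + n) (α + 1) with hB'
  have hBpos : 0 < B := ProbabilityTheory.beta_pos (by linarith) (by linarith)
  have hBpos' : 0 < B' := ProbabilityTheory.beta_pos (by positivity [show 0 < β + 1 by linarith])
    (by linarith)
  set b := ProbabilityTheory.betaPDFReal (β + 1 + n) (α + 1) with hb
  set f : ℝ → ℝ := fun t => if t < 1 then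
    t ^ (2 * β) * (1 - t ^ 2) ^ α / (Real.pi * B) * t ^ (2 * n) else 0 with hf
  have hind : (fun z : ℂ => f ‖z‖)
      = (ball (0 : ℂ) 1).indicator fun z => density α β z • ‖z‖ ^ (2 * n) := by
    funext z
    by_cases hz : ‖z‖ < 1
    · rw [Set.indicator_of_mem (by simpa using hz)]
      simp [hf, hz, density, hB]
    · rw [Set.indicator_of_notMem (by simpa using hz)]
      simp [hf, hz]
  have hfb : Set.EqOn (fun y : ℝ => y ^ (Module.finrank ℝ ℂ - 1) • f y)
      (fun y => (B' / (2 * Real.pi * B)) • ((|(2 : ℝ)| * y ^ ((2 : ℝ) - 1)) • b (y ^ (2 : ℝ))))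
      (Set.Ioi 0) := by
    intro y (hy : 0 < y)
    simp only [Complex.finrank_real_complex, smul_eq_mul, hf, hb, ProbabilityTheory.betaPDFReal,
      ← hB', Real.rpow_two, show (2 : ℝ) - 1 = 1 by norm_num, Real.rpow_one, abs_two]
    by_cases h1 : y < 1
    · have h2 : 0 < y ^ 2 ∧ y ^ 2 < 1 := ⟨by positivity, by nlinarith⟩
      rw [if_pos h1, if_pos h2]
      have e1 : (y ^ 2) ^ (β + 1 + n - 1) = y ^ (2 * β) * y ^ (2 * n) := by
        rw [← Real.rpow_natCast y 2, ← Real.rpow_mul hy.le, ← Real.rpow_natCast y (2 * n),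
          ← Real.rpow_add hy]
        congr 1
        push_cast; ring
      rw [e1, show α + 1 - 1 = α by ring]
      field_simp
      simp
    · have h2 : ¬ (0 < y ^ 2 ∧ y ^ 2 < 1) := fun h => h1 (by nlinarith [h.2])
      rw [if_neg h1, if_neg h2]; simp
  have hbnn : ∀ x, 0 ≤ b x := by
    intro x
    simp only [hb, ProbabilityTheory.betaPDFReal]
    split_ifs with hx
    · have : 0 < 1 - x := by linarith [hx.2]
      have := hx.1
      positivity
    · exact le_rfl
  have hbint : Integrable b := by
    refine ⟨(ProbabilityTheory.measurable_betaPDFReal _ _).aestronglyMeasurable, ?_⟩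
    rw [hasFiniteIntegral_iff_ofReal]
    · have := ProbabilityTheory.lintegral_betaPDF_eq_one (α := β + 1 + n) (β := α + 1)
        (by positivity [show 0 < β + 1 by linarith]) (by linarith)
      simp only [ProbabilityTheory.betaPDF] at this
      rw [hb, this]; exact ENNReal.one_lt_top
    · exact Eventually.of_forall hbnn
  have hb1 : ∫ x in Set.Ioi 0, b x = 1 := by
    have h0 : ∫ x in Set.Ioi 0, b x = ∫ x, b x := by
      refine setIntegral_eq_integral_of_forall_compl_eq_zero fun x hx => ?_
      simp only [hb, ProbabilityTheory.betaPDFReal]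
      rw [if_neg]
      intro h; exact hx h.1
    rw [h0, integral_eq_lintegral_of_nonneg_ae _ hbint.aestronglyMeasurable]
    · have := ProbabilityTheory.lintegral_betaPDF_eq_one (α := β + 1 + n) (β := α + 1)
        (by positivity [show 0 < β + 1 by linarith]) (by linarith)
      simp only [ProbabilityTheory.betaPDF] at this
      rw [hb, this]; simp
    · exact Eventually.of_forall hbnn
  rw [integrable_measure_iff hα hβ, integral_measure hα hβ]
  constructor
  · rw [← integrable_indicator_iff measurableSet_ball, ← hind,
      integrable_fun_norm_addHaar, integrableOn_congr_fun hfb measurableSet_Ioi]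
    exact ((integrableOn_Ioi_comp_rpow_iff b two_ne_zero).2 hbint.integrableOn).smul
      (B' / (2 * Real.pi * B))
  · rw [← integral_indicator measurableSet_ball, ← hind, integral_fun_norm_addHaar,
      setIntegral_congr_fun measurableSet_Ioi hfb, integral_smul,
      integral_comp_rpow_Ioi b two_ne_zero, hb1, Complex.finrank_real_complex, Measure.real,
      Complex.volume_ball, ← beta_div_beta hα hβ]
    simp only [ENNReal.ofReal_one, one_pow, one_mul, ENNReal.coe_toReal, NNReal.coe_real_pi,
      smul_eq_mul, nsmul_eq_mul, mul_one, ← hB, ← hB']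
    have := Real.pi_pos
    push_cast
    field_simp

lemma isProbabilityMeasure_measure {α β : ℝ} (hα : -1 < α) (hβ : -1 < β) :
    IsProbabilityMeasure (measure α β) := by
  obtain ⟨h1, h2⟩ := integrable_and_integral_norm_pow hα hβ 0
  simp only [mul_zero, pow_zero] at h1 h2
  have : IsFiniteMeasure (measure α β) := by
    rw [integrable_const_iff] at h1
    simpa using h1
  constructor
  have h3 : (measure α β).real Set.univ = 1 := by simpa [moment] using h2
  rw [Measure.real, ENNReal.toReal_eq_one_iff] at h3
  exact h3

lemma moment_le_one {α β : ℝ} (hα : -1 < α) (hβ : -1 < β) (n : ℕ) : moment α β n ≤ 1 := by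
  have := isProbabilityMeasure_measure hα hβ
  obtain ⟨h1, h2⟩ := integrable_and_integral_norm_pow hα hβ n
  rw [← h2]
  calc ∫ z, ‖z‖ ^ (2 * n) ∂measure α β ≤ ∫ _, (1 : ℝ) ∂measure α β := by
        refine integral_mono_ae h1 (integrable_const 1) ?_
        filter_upwards [ae_mem_ball α β] with z hz
        exact pow_le_one₀ (norm_nonneg z) (mem_ball_zero_iff.1 hz).le
    _ = 1 := by simp

lemma one_le_inv_moment {α β : ℝ} (hα : -1 < α) (hβ : -1 < β) (n : ℕ) : 1 ≤ (moment α β n)⁻¹ :=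
  (one_le_inv₀ (moment_pos hα hβ n)).2 (moment_le_one hα hβ n)

/-! ### The kernel as a power series -/

lemma ascPochhammer_eval_ofReal (x : ℝ) (n : ℕ) :
    (ascPochhammer ℂ n).eval (x : ℂ) = (((ascPochhammer ℝ n).eval x : ℝ) : ℂ) := by
  induction n with
  | zero => simp
  | succ n ih => rw [ascPochhammer_succ_eval, ascPochhammer_succ_eval, ih]; push_cast; ring

/-- The Pochhammer symbol of the parameter 1 cancels n!, and the remaining quotient is the
reciprocal of the n-th moment. This is why the hypergeometric function reproduces. -/
lemma hypergeometric_term (α β : ℝ) (x : ℂ) (n : ℕ) :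
    (ordinaryHypergeometricSeries ℂ (1 : ℂ) ((α : ℂ) + β + 2) ((β : ℂ) + 1) n fun _ => x)
      = ((moment α β n)⁻¹ : ℝ) * x ^ n := by
  rw [ordinaryHypergeometricSeries_apply_eq, ascPochhammer_eval_one,
    show (α : ℂ) + β + 2 = ((α + β + 2 : ℝ) : ℂ) by push_cast; ring,
    show (β : ℂ) + 1 = ((β + 1 : ℝ) : ℂ) by push_cast; ring, ascPochhammer_eval_ofReal,
    ascPochhammer_eval_ofReal, moment]
  have : ((n.factorial : ℕ) : ℂ) ≠ 0 := by exact_mod_cast n.factorial_ne_zero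
  rw [inv_mul_cancel₀ this]
  push_cast
  simp only [smul_eq_mul, one_mul, inv_div]
  rw [div_eq_mul_inv]

lemma hypergeometric_radius {α β : ℝ} (hα : -1 < α) (hβ : -1 < β) :
    (ordinaryHypergeometricSeries ℂ (1 : ℂ) ((α : ℂ) + β + 2) ((β : ℂ) + 1)).radius = 1 := by
  refine ordinaryHypergeometricSeries_radius_eq_one ℂ _ _ _ fun k => ⟨?_, ?_, ?_⟩ <;>
    intro h <;> have h' := congrArg Complex.re h <;> simp at h' <;>
    linarith [(Nat.cast_nonneg k : (0 : ℝ) ≤ k)]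

lemma summable_inv_moment_mul_pow {α β : ℝ} (hα : -1 < α) (hβ : -1 < β) {r : ℝ} (h0 : 0 ≤ r)
    (h1 : r < 1) : Summable fun n => (moment α β n)⁻¹ * r ^ n := by
  have hx : (r : ℂ) ∈ eball (0 : ℂ)
      (ordinaryHypergeometricSeries ℂ (1 : ℂ) ((α : ℂ) + β + 2) ((β : ℂ) + 1)).radius := by
    rw [hypergeometric_radius hα hβ, mem_eball, edist_zero_right, enorm_eq_nnnorm]
    rw [← ENNReal.coe_one, ENNReal.coe_lt_coe, ← NNReal.coe_lt_coe]
    simpa [abs_of_nonneg h0] using h1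
  refine (FormalMultilinearSeries.summable_norm_apply _ hx).congr fun n => ?_
  rw [hypergeometric_term, norm_mul, Complex.norm_real, norm_pow, Complex.norm_real,
    Real.norm_of_nonneg h0, Real.norm_of_nonneg (inv_nonneg.2 (moment_pos hα hβ n).le)]

lemma norm_mul_conj_lt_one {w z : ℂ} (hw : ‖w‖ ≤ 1) (hz : ‖z‖ < 1) : ‖w * conj z‖ < 1 := by
  rw [norm_mul, RCLike.norm_conj]
  nlinarith [norm_nonneg w, norm_nonneg z]

lemma hasSum_kernel {α β : ℝ} (hα : -1 < α) (hβ : -1 < β) {w z : ℂ} (h : ‖w * conj z‖ < 1) :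
    HasSum (fun n => (((moment α β n)⁻¹ : ℝ) : ℂ) * (w * conj z) ^ n) (kernel α β w z) := by
  have hs : Summable fun n => (((moment α β n)⁻¹ : ℝ) : ℂ) * (w * conj z) ^ n := by
    refine Summable.of_norm ?_
    refine (summable_inv_moment_mul_pow hα hβ (norm_nonneg (w * conj z)) h).congr fun n => ?_
    rw [norm_mul (Complex.ofReal _), Complex.norm_real, norm_pow,
      Real.norm_of_nonneg (inv_nonneg.2 (moment_pos hα hβ n).le)]
  convert hs.hasSum using 1
  rw [kernel, ordinaryHypergeometric, FormalMultilinearSeries.sum]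
  exact tsum_congr fun n => hypergeometric_term α β _ n

/-! ### A Forelli–Rudin estimate -/

lemma hasSum_one_sub_rpow_neg (a : ℝ) {x : ℝ} (h0 : 0 ≤ x) (h1 : x < 1) :
    HasSum (fun n : ℕ => (ascPochhammer ℝ n).eval a / n.factorial * x ^ n) ((1 - x) ^ (-a)) := by
  have := (Real.one_div_one_sub_rpow_hasFPowerSeriesOnBall_zero a).hasSum (y := x) (by
    rw [mem_eball, edist_zero_right, enorm_eq_nnnorm, ← ENNReal.coe_one, ENNReal.coe_lt_coe,
      ← NNReal.coe_lt_coe]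
    simpa [abs_of_nonneg h0] using h1)
  rw [zero_add, one_div, ← Real.rpow_neg (by linarith)] at this
  simp only [FormalMultilinearSeries.ofScalars_apply_eq, ← Ring.multichoose_eq,
    smul_eq_mul] at this
  have hfun : (fun n : ℕ => (ascPochhammer ℝ n).eval a / n.factorial * x ^ n)
      = fun n => Ring.multichoose a n * x ^ n := by
    funext n
    have h2 := Ring.factorial_nsmul_multichoose_eq_ascPochhammer a n
    rw [Polynomial.ascPochhammer_smeval_eq_eval, nsmul_eq_mul] at h2
    rw [← h2, mul_div_cancel_left₀ _ (by exact_mod_cast n.factorial_ne_zero)]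
  rw [hfun]
  exact this

/-- Bounds the coefficients of the radial integral in `integral_radial_le` by those of a geometric
series. -/
lemma ascPochhammer_mul_moment_le {α β : ℝ} (hα : -1 < α) (hβ : -1 < β) (hβ0 : β ≤ 0) (n : ℕ) :
    (ascPochhammer ℝ n).eval (α + 2) / n.factorial * moment α β n ≤ 1 := by
  have key : (ascPochhammer ℝ n).eval (α + 2) * (ascPochhammer ℝ n).eval (β + 1)
      ≤ n.factorial * (ascPochhammer ℝ n).eval (α + β + 2) := by
    induction n with
    | zero => simp
    | succ n ih =>
      simp only [ascPochhammer_succ_eval, Nat.factorial_succ]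
      push_cast
      have hn : (0 : ℝ) ≤ n := Nat.cast_nonneg n
      -- The right side minus the left side is -(α+1)β, which is nonnegative as β ≤ 0.
      have h1 : (α + 2 + n) * (β + 1 + n) ≤ (n + 1) * (α + β + 2 + n) := by nlinarith
      have h2 : 0 ≤ (α + 2 + n) * (β + 1 + n) := mul_nonneg (by linarith) (by linarith)
      have h3 := ascPochhammer_pos n (α + β + 2) (by linarith)
      calc _ = ((ascPochhammer ℝ n).eval (α + 2) * (ascPochhammer ℝ n).eval (β + 1)) *
            ((α + 2 + n) * (β + 1 + n)) := by ring
        _ ≤ (n.factorial * (ascPochhammer ℝ n).eval (α + β + 2)) *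
            ((n + 1) * (α + β + 2 + n)) := mul_le_mul ih h1 h2 (by positivity)
        _ = _ := by ring
  have h3 := ascPochhammer_pos n (α + β + 2) (by linarith)
  have h4 : (0 : ℝ) < n.factorial := by exact_mod_cast n.factorial_pos
  rw [moment, div_mul_div_comm, div_le_one (by positivity)]
  exact key

lemma integral_radial_le {α β : ℝ} (hα : -1 < α) (hβ : -1 < β) (hβ0 : β ≤ 0) {s : ℝ}
    (h0 : 0 ≤ s) (h1 : s < 1) :
    ∫ w, (1 - s ^ 2 * ‖w‖ ^ 2) ^ (-(α + 2)) ∂measure α β ≤ (1 - s ^ 2)⁻¹ := by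
  have hs1 : s ^ 2 < 1 := by nlinarith
  set c : ℕ → ℝ := fun n => (ascPochhammer ℝ n).eval (α + 2) / n.factorial with hc
  have hc0 : ∀ n, 0 ≤ c n := fun n =>
    div_nonneg (ascPochhammer_pos n _ (by linarith)).le (Nat.cast_nonneg _)
  set F : ℕ → ℂ → ℝ := fun n w => c n * s ^ (2 * n) * ‖w‖ ^ (2 * n) with hF
  have hFi : ∀ n, Integrable (F n) (measure α β) := fun n =>
    (integrable_and_integral_norm_pow hα hβ n).1.const_mul _
  have hFint : ∀ n, ∫ w, F n w ∂measure α β = c n * moment α β n * (s ^ 2) ^ n := fun n => by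
    simp only [hF]
    rw [integral_const_mul, (integrable_and_integral_norm_pow hα hβ n).2, pow_mul]; ring
  have hFnorm : ∀ n, ∫ w, ‖F n w‖ ∂measure α β = ∫ w, F n w ∂measure α β := fun n => by
    refine integral_congr_ae (Eventually.of_forall fun w => ?_)
    exact Real.norm_of_nonneg (mul_nonneg (mul_nonneg (hc0 n) (by positivity)) (by positivity))
  have hle : ∀ n, ∫ w, F n w ∂measure α β ≤ (s ^ 2) ^ n := fun n => by
    rw [hFint]
    exact mul_le_of_le_one_left (by positivity) (ascPochhammer_mul_moment_le hα hβ hβ0 n)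
  have hgeo := hasSum_geometric_of_lt_one (sq_nonneg s) hs1
  have hsum : Summable fun n => ∫ w, ‖F n w‖ ∂measure α β := by
    refine Summable.of_nonneg_of_le (fun n => integral_nonneg fun _ => norm_nonneg _) (fun n => ?_)
      hgeo.summable
    rw [hFnorm]; exact hle n
  have h2 := hasSum_integral_of_summable_integral_norm hFi hsum
  have h3 : ∫ w, (1 - s ^ 2 * ‖w‖ ^ 2) ^ (-(α + 2)) ∂measure α β
      = ∫ w, ∑' n, F n w ∂measure α β := by
    refine integral_congr_ae ?_
    filter_upwards [ae_mem_ball α β] with w hw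
    have hw' := mem_ball_zero_iff.1 hw
    have hx : s ^ 2 * ‖w‖ ^ 2 < 1 := by nlinarith [norm_nonneg w, sq_nonneg s]
    rw [← (hasSum_one_sub_rpow_neg (α + 2) (by positivity) hx).tsum_eq]
    refine tsum_congr fun n => ?_
    simp only [hF, hc]
    rw [mul_pow, ← pow_mul, ← pow_mul]; ring
  rw [h3]
  exact hasSum_le hle h2 hgeo

lemma norm_one_sub_conj_mul_ge {a w : ℂ} : 1 - ‖a‖ * ‖w‖ ≤ ‖1 - conj a * w‖ := by
  have := norm_sub_norm_le (1 : ℂ) (conj a * w)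
  simpa using this

lemma integrable_norm_one_sub_mul_rpow {α β : ℝ} (hα : -1 < α) (hβ : -1 < β) {a : ℂ}
    (ha : ‖a‖ < 1) {T : ℝ} (hT : 0 ≤ T) :
    Integrable (fun w => ‖1 - conj a * w‖ ^ (-T)) (measure α β) := by
  have := isProbabilityMeasure_measure hα hβ
  refine Integrable.of_bound (C := (1 - ‖a‖) ^ (-T)) ?_ ?_
  · exact (by fun_prop : Measurable fun w : ℂ => ‖1 - conj a * w‖ ^ (-T)).aestronglyMeasurable
  · filter_upwards [ae_mem_ball α β] with w hw
    have hw' := mem_ball_zero_iff.1 hw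
    have : 1 - ‖a‖ ≤ ‖1 - conj a * w‖ := by
      nlinarith [norm_one_sub_conj_mul_ge (a := a) (w := w), norm_nonneg a]
    rw [Real.norm_of_nonneg (by positivity)]
    exact Real.rpow_le_rpow_of_nonpos (by linarith) this (by linarith)

/-- Let q = 1 - |a|²|w|². Two of the T powers of 1/|1-āw| are kept and have circle average 1/q; the
other T - 2 are bounded by means of |1-āw| ≥ q/2. In the resulting q^{-(T-1)}, the power beyond α +
2 is estimated by q ≥ 1 - |a|², and `integral_radial_le` handles q^{-(α+2)}. -/
lemma integral_norm_one_sub_mul_rpow_le {α β : ℝ} (hα : -1 < α) (hβ : -1 < β) (hβ0 : β ≤ 0)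
    {a : ℂ} (ha : ‖a‖ < 1) {T : ℝ} (hT : α + 3 ≤ T) :
    ∫ w, ‖1 - conj a * w‖ ^ (-T) ∂measure α β ≤ 2 ^ (T - 2) * (1 - ‖a‖ ^ 2) ^ (α + 2 - T) := by
  have := isProbabilityMeasure_measure hα hβ
  have hδ : 0 < 1 - ‖a‖ ^ 2 := by nlinarith [norm_nonneg a]
  set q : ℂ → ℝ := fun w => 1 - ‖a‖ ^ 2 * ‖w‖ ^ 2 with hq
  have hq1 : ∀ w ∈ ball (0 : ℂ) 1, 1 - ‖a‖ ^ 2 ≤ q w := fun w hw => by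
    have := mem_ball_zero_iff.1 hw
    simp only [hq]
    have : ‖w‖ ^ 2 ≤ 1 := by nlinarith [norm_nonneg w]
    nlinarith [sq_nonneg ‖a‖]
  have hqm : Measurable q := by fun_prop
  have hqint : ∀ S : ℝ, 0 ≤ S → Integrable (fun w => q w ^ (-S)) (measure α β) := fun S hS => by
    refine Integrable.of_bound (C := (1 - ‖a‖ ^ 2) ^ (-S))
      (by fun_prop : Measurable fun w => q w ^ (-S)).aestronglyMeasurable ?_
    filter_upwards [ae_mem_ball α β] with w hw
    have := hq1 w hw
    rw [Real.norm_of_nonneg (by positivity [hδ.trans_le this])]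
    exact Real.rpow_le_rpow_of_nonpos hδ this (by linarith)
  set g : ℂ → ℝ := fun w => (‖1 - conj a * w‖ ^ 2)⁻¹ * (q w) ^ (-(T - 2)) with hg
  have hge : ∀ w ∈ ball (0 : ℂ) 1, q w / 2 ≤ ‖1 - conj a * w‖ := fun w hw => by
    have hw' := mem_ball_zero_iff.1 hw
    have h2 := norm_one_sub_conj_mul_ge (a := a) (w := w)
    simp only [hq]
    have h3 : ‖a‖ * ‖w‖ < 1 := by nlinarith [norm_nonneg a, norm_nonneg w]
    nlinarith [mul_nonneg (norm_nonneg a) (norm_nonneg w)]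
  have hgint : Integrable g (measure α β) := by
    refine Integrable.of_bound (C := ((1 - ‖a‖) ^ 2)⁻¹ * (1 - ‖a‖ ^ 2) ^ (-(T - 2)))
      (by fun_prop : Measurable g).aestronglyMeasurable ?_
    filter_upwards [ae_mem_ball α β] with w hw
    have hw' := mem_ball_zero_iff.1 hw
    have h1 := hq1 w hw
    have h2 : 1 - ‖a‖ ≤ ‖1 - conj a * w‖ := by
      nlinarith [norm_one_sub_conj_mul_ge (a := a) (w := w), norm_nonneg a]
    have h3 := hδ.trans_le h1
    rw [Real.norm_of_nonneg (by positivity)]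
    refine mul_le_mul ?_ (Real.rpow_le_rpow_of_nonpos hδ h1 (by linarith)) (by positivity)
      (by positivity)
    have : 0 < 1 - ‖a‖ := by linarith
    gcongr
  have hgav := (rotationInvariant_measure α β).integral_eq_integral_circleAverage
    (g := fun w => ((g w : ℝ) : ℂ)) hgint.ofReal
  have hav : ∫ w, g w ∂measure α β = ∫ w, q w ^ (-(T - 1)) ∂measure α β := by
    have hcongr : ∫ w, Real.circleAverage (fun w => ((g w : ℝ) : ℂ)) 0 ‖w‖ ∂measure α β
        = ∫ w, ((q w ^ (-(T - 1)) : ℝ) : ℂ) ∂measure α β := by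
      refine integral_congr_ae ?_
      filter_upwards [ae_mem_ball α β] with w hw
      have hw' := mem_ball_zero_iff.1 hw
      have hqw := hδ.trans_le (hq1 w hw)
      have : Set.EqOn (fun u => ((g u : ℝ) : ℂ))
          (fun u => (((q w) ^ (-(T - 2)) : ℝ) : ℂ) • (((‖1 - conj a * u‖ ^ 2)⁻¹ : ℝ) : ℂ))
          (sphere 0 |‖w‖|) := by
        intro u hu
        have hu' : ‖u‖ = ‖w‖ := by simpa using hu
        simp only [hg, hq, hu', smul_eq_mul]
        push_cast; ring
      rw [Real.circleAverage_congr_sphere this, Real.circleAverage_fun_smul,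
        circleAverage_norm_one_sub_mul_rpow ha (norm_nonneg w) hw', smul_eq_mul,
        ← Complex.ofReal_mul]
      congr 1
      rw [show -(T - 1) = -(T - 2) + -1 by ring, Real.rpow_add hqw, Real.rpow_neg_one]
    rw [hcongr] at hgav
    have e1 : ∫ w, ((g w : ℝ) : ℂ) ∂measure α β = ((∫ w, g w ∂measure α β : ℝ) : ℂ) :=
      integral_ofReal
    have e2 : ∫ w, ((q w ^ (-(T - 1)) : ℝ) : ℂ) ∂measure α β
      = ((∫ w, q w ^ (-(T - 1)) ∂measure α β : ℝ) : ℂ) := integral_ofReal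
    exact_mod_cast (e1.symm.trans hgav).trans e2
  calc ∫ w, ‖1 - conj a * w‖ ^ (-T) ∂measure α β
      ≤ ∫ w, 2 ^ (T - 2) * g w ∂measure α β := by
        refine integral_mono_ae (integrable_norm_one_sub_mul_rpow hα hβ ha (by linarith))
          (hgint.const_mul _) ?_
        filter_upwards [ae_mem_ball α β] with w hw
        have hqw := hδ.trans_le (hq1 w hw)
        have hn : 0 < ‖1 - conj a * w‖ := lt_of_lt_of_le (by positivity) (hge w hw)
        have h2 : ‖1 - conj a * w‖ ^ (-(T - 2)) ≤ (q w / 2) ^ (-(T - 2)) :=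
          Real.rpow_le_rpow_of_nonpos (by positivity) (hge w hw) (by linarith)
        rw [Real.div_rpow hqw.le two_pos.le, Real.rpow_neg two_pos.le, div_inv_eq_mul] at h2
        rw [show -T = -2 + -(T - 2) by ring, Real.rpow_add hn, Real.rpow_neg hn.le, Real.rpow_two]
        calc _ ≤ (‖1 - conj a * w‖ ^ 2)⁻¹ * (q w ^ (-(T - 2)) * 2 ^ (T - 2)) := by gcongr
          _ = _ := by simp only [hg]; ring
    _ = 2 ^ (T - 2) * ∫ w, q w ^ (-(T - 1)) ∂measure α β := by rw [integral_const_mul, hav]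
    _ ≤ 2 ^ (T - 2) * ∫ w, (1 - ‖a‖ ^ 2) ^ (α + 3 - T) * q w ^ (-(α + 2)) ∂measure α β := by
        refine mul_le_mul_of_nonneg_left ?_ (by positivity)
        refine integral_mono_ae (hqint _ (by linarith)) ((hqint _ (by linarith)).const_mul _) ?_
        filter_upwards [ae_mem_ball α β] with w hw
        have hqw := hδ.trans_le (hq1 w hw)
        rw [show -(T - 1) = (α + 3 - T) + -(α + 2) by ring, Real.rpow_add hqw]
        gcongr ?_ * _
        exact Real.rpow_le_rpow_of_nonpos hδ (hq1 w hw) (by linarith)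
    _ ≤ 2 ^ (T - 2) * ((1 - ‖a‖ ^ 2) ^ (α + 3 - T) * (1 - ‖a‖ ^ 2)⁻¹) := by
        rw [integral_const_mul]
        gcongr
        exact integral_radial_le hα hβ hβ0 (norm_nonneg a) ha
    _ = 2 ^ (T - 2) * (1 - ‖a‖ ^ 2) ^ (α + 2 - T) := by
        rw [← Real.rpow_neg_one, ← Real.rpow_add hδ]
        congr 2; ring

/-! ### Holomorphic representatives -/

lemma density_pos {α β : ℝ} (hα : -1 < α) (hβ : -1 < β) {z : ℂ} (hz0 : z ≠ 0) (hz : ‖z‖ < 1) :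
    0 < density α β z := by
  have h1 : 0 < 1 - ‖z‖ ^ 2 := by nlinarith [norm_nonneg z]
  have h2 := norm_pos_iff.2 hz0
  have := ProbabilityTheory.beta_pos (α := α + 1) (β := β + 1) (by linarith) (by linarith)
  unfold density
  have := Real.pi_pos
  positivity

/-- The density vanishes in the disk at most at the origin. So equality μ-almost everywhere is
equality Lebesgue-almost everywhere, to which continuity applies. -/
lemma volume_restrict_absolutelyContinuous {α β : ℝ} (hα : -1 < α) (hβ : -1 < β) :
    (volume.restrict (ball (0 : ℂ) 1)) ≪ measure α β := by
  refine withDensity_absolutelyContinuous' (measurable_ofReal_density α β).aemeasurable ?_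
  filter_upwards [ae_restrict_mem measurableSet_ball, ae_restrict_of_ae (Measure.ae_ne volume 0)]
    with z hz hz0
  simpa using density_pos hα hβ hz0 (mem_ball_zero_iff.1 hz)

lemma isOpen_punctured : IsOpen (ball (0 : ℂ) 1 \ {0}) := isOpen_ball.sdiff isClosed_singleton

/-- Holomorphic functions on the punctured disk that agree almost everywhere are equal there. -/
lemma eqOn_punctured_of_ae_eq {α β : ℝ} (hα : -1 < α) (hβ : -1 < β) {F G : ℂ → ℂ}
    (hF : ContinuousOn F (ball 0 1 \ {0})) (hG : ContinuousOn G (ball 0 1 \ {0}))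
    (h : F =ᵐ[measure α β] G) : Set.EqOn F G (ball 0 1 \ {0}) := by
  have h1 := (volume_restrict_absolutelyContinuous hα hβ).ae_eq h
  exact Measure.eqOn_open_of_ae_eq (μ := volume) (ae_restrict_of_ae_restrict_of_subset
    Set.sdiff_subset h1) isOpen_punctured hF hG

lemma ae_eq_of_eqOn {α β : ℝ} {F G : ℂ → ℂ} (h : Set.EqOn F G (ball 0 1)) :
    F =ᵐ[measure α β] G := by
  filter_upwards [ae_mem_ball α β] with z hz using h hz

lemma ae_eq_holo {α β : ℝ} {p : ℝ≥0∞} (f : Space α β p) : f =ᵐ[measure α β] holo f := by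
  filter_upwards [(Classical.choose_spec f.2).2, ae_ne_zero α β] with z hz hz0
  rw [hz, holo, Function.update_of_ne hz0]

/-- Frees `holo` from the arbitrary choice in its definition: any representative holomorphic on the
whole disk agrees with it, at the origin too, where the limit was inserted. -/
lemma holo_eqOn {α β : ℝ} (hα : -1 < α) (hβ : -1 < β) {p : ℝ≥0∞} (f : Space α β p) {G : ℂ → ℂ}
    (hG : DifferentiableOn ℂ G (ball 0 1)) (h : f =ᵐ[measure α β] G) :
    Set.EqOn (holo f) G (ball 0 1) := by
  have h1 : Set.EqOn (Classical.choose f.2) G (ball 0 1 \ {0}) :=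
    eqOn_punctured_of_ae_eq hα hβ (Classical.choose_spec f.2).1.continuousOn
      (hG.continuousOn.mono Set.sdiff_subset) ((Classical.choose_spec f.2).2.symm.trans h)
  intro z hz
  rcases eq_or_ne z 0 with rfl | hz0
  · rw [holo, Function.update_self]
    refine Tendsto.limUnder_eq ?_
    have hc : Tendsto G (𝓝[≠] 0) (𝓝 (G 0)) :=
      (hG.continuousOn.continuousAt (isOpen_ball.mem_nhds hz)).tendsto.mono_left
        nhdsWithin_le_nhds
    refine hc.congr' ?_
    filter_upwards [nhdsWithin_le_nhds (isOpen_ball.mem_nhds hz), self_mem_nhdsWithin]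
      with w hw hw0
    exact (h1 ⟨hw, hw0⟩).symm
  · rw [holo, Function.update_of_ne hz0]
    exact h1 ⟨hz, hz0⟩

/-- The element of the Bergman space given by a function holomorphic on the disk. -/
noncomputable def ofHolo {α β : ℝ} {p : ℝ≥0∞} (G : ℂ → ℂ) (hG : DifferentiableOn ℂ G (ball 0 1))
    (hm : MemLp G p (measure α β)) : Space α β p :=
  ⟨hm.toLp G, G, hG.mono Set.sdiff_subset, hm.coeFn_toLp⟩

lemma ofHolo_ae_eq {α β : ℝ} {p : ℝ≥0∞} {G : ℂ → ℂ} (hG : DifferentiableOn ℂ G (ball 0 1))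
    (hm : MemLp G p (measure α β)) : ofHolo G hG hm =ᵐ[measure α β] G := hm.coeFn_toLp

lemma holo_ofHolo {α β : ℝ} (hα : -1 < α) (hβ : -1 < β) {p : ℝ≥0∞} {G : ℂ → ℂ}
    (hG : DifferentiableOn ℂ G (ball 0 1)) (hm : MemLp G p (measure α β)) :
    Set.EqOn (holo (ofHolo G hG hm)) G (ball 0 1) :=
  holo_eqOn hα hβ _ hG (ofHolo_ae_eq hG hm)

lemma memLp_of_bound {α β : ℝ} (hα : -1 < α) (hβ : -1 < β) {p : ℝ≥0∞} {G : ℂ → ℂ}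
    (hG : ContinuousOn G (ball 0 1)) {C : ℝ} (hC : ∀ z ∈ ball (0 : ℂ) 1, ‖G z‖ ≤ C) :
    MemLp G p (measure α β) := by
  have := isProbabilityMeasure_measure hα hβ
  refine MemLp.of_bound ?_ C ?_
  · exact (hG.aestronglyMeasurable measurableSet_ball).mono_ac (withDensity_absolutelyContinuous _ _)
  · filter_upwards [ae_mem_ball α β] with z hz using hC z hz

/-- On a smaller disk the density is bounded from below. -/
lemma exists_le_density {α β : ℝ} (hα : -1 < α) (hβ : -1 < β) (hβ0 : β ≤ 0) :
    ∃ c > 0, ∀ z : ℂ, z ≠ 0 → ‖z‖ ≤ 1 / 2 → c ≤ density α β z := by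
  have hB := ProbabilityTheory.beta_pos (α := α + 1) (β := β + 1) (by linarith) (by linarith)
  have hpi := Real.pi_pos
  refine ⟨min 1 ((3 / 4 : ℝ) ^ α) / (Real.pi * ProbabilityTheory.beta (α + 1) (β + 1)),
    by positivity, fun z hz0 hz => ?_⟩
  have hz' := norm_pos_iff.2 hz0
  unfold density
  gcongr
  have h1 : 1 ≤ ‖z‖ ^ (2 * β) :=
    Real.one_le_rpow_of_pos_of_le_one_of_nonpos hz' (by linarith) (by linarith)
  -- Here 3/4 ≤ 1 - |z|² ≤ 1; the minimum covers both signs of α.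
  have h2 : min 1 ((3 / 4 : ℝ) ^ α) ≤ (1 - ‖z‖ ^ 2) ^ α := by
    rcases le_total 0 α with h | h
    · exact (min_le_right _ _).trans
        (Real.rpow_le_rpow (by norm_num) (by nlinarith) h)
    · exact (min_le_left _ _).trans
        (Real.one_le_rpow_of_pos_of_le_one_of_nonpos (by nlinarith) (by nlinarith) h)
  calc min 1 ((3 / 4 : ℝ) ^ α) ≤ 1 * (1 - ‖z‖ ^ 2) ^ α := by rwa [one_mul]
    _ ≤ _ := by
      have : 0 ≤ 1 - ‖z‖ ^ 2 := by nlinarith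
      gcongr

/-- Square integrable functions that are holomorphic on the punctured disk have a removable
singularity at the origin. -/
lemma differentiableOn_holo {α β : ℝ} (hα : -1 < α) (hβ : -1 < β) (hβ0 : β ≤ 0)
    (f : Space α β 2) : DifferentiableOn ℂ (holo f) (ball 0 1) := by
  set F := Classical.choose f.2 with hFdef
  have hF : DifferentiableOn ℂ F (ball 0 1 \ {0}) := (Classical.choose_spec f.2).1
  have hfF : f =ᵐ[measure α β] F := (Classical.choose_spec f.2).2
  have hm : MemLp F 2 (measure α β) := (memLp_congr_ae hfF).1 (Lp.memLp _)
  have hint : Integrable (fun z => ‖F z‖ ^ 2) (measure α β) :=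
    (memLp_two_iff_integrable_sq_norm hm.aestronglyMeasurable).1 hm
  obtain ⟨c, hc, hcd⟩ := exists_le_density hα hβ hβ0
  have hfin : ∫⁻ z in ball (0 : ℂ) (1 / 2), ENNReal.ofReal (‖F z‖ ^ 2) ≠ ∞ := by
    have h1 := ((integrable_measure_iff hα hβ).1 hint).2
    rw [hasFiniteIntegral_iff_ofReal] at h1
    · have h2 : ENNReal.ofReal c * ∫⁻ z in ball (0 : ℂ) (1 / 2), ENNReal.ofReal (‖F z‖ ^ 2)
          ≤ ∫⁻ z in ball (0 : ℂ) 1, ENNReal.ofReal (density α β z • ‖F z‖ ^ 2) := by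
        rw [← lintegral_const_mul' _ _ ENNReal.ofReal_ne_top]
        refine le_trans ?_ (lintegral_mono_set (ball_subset_ball (by norm_num : (1 / 2 : ℝ) ≤ 1)))
        refine lintegral_mono_ae ?_
        filter_upwards [ae_restrict_mem measurableSet_ball,
          ae_restrict_of_ae (Measure.ae_ne volume 0)] with z hz hz0
        rw [← ENNReal.ofReal_mul hc.le, smul_eq_mul]
        gcongr
        exact hcd z hz0 (mem_ball_zero_iff.1 hz).le
      intro htop
      rw [htop, ENNReal.mul_top (by simpa using hc)] at h2
      exact absurd (h2.trans_lt h1) (lt_irrefl _)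
    · filter_upwards [ae_restrict_mem measurableSet_ball] with z hz
      exact mul_nonneg (density_nonneg hα hβ (mem_ball_zero_iff.1 hz)) (by positivity)
  have hvol : Tendsto (fun w : ℂ => Real.pi * ‖w‖ ^ 2) (𝓝[≠] 0) (𝓝 0) := by
    have : Continuous fun w : ℂ => Real.pi * ‖w‖ ^ 2 := by fun_prop
    simpa using (this.tendsto 0).mono_left nhdsWithin_le_nhds
  -- Absolute continuity of the integral: the area of the disk about w through the origin shrinks to
  -- 0.
  have hsmall : Tendsto (fun w : ℂ => ∫⁻ z in ball w ‖w‖, ENNReal.ofReal (‖F z‖ ^ 2)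
      ∂(volume.restrict (ball (0 : ℂ) (1 / 2)))) (𝓝[≠] 0) (𝓝 0) := by
    refine tendsto_setLIntegral_zero hfin ?_
    refine tendsto_of_tendsto_of_tendsto_of_le_of_le tendsto_const_nhds
      (h := fun w : ℂ => ENNReal.ofReal (Real.pi * ‖w‖ ^ 2)) ?_ (fun _ => zero_le)
      (fun w => ?_)
    · simpa using ENNReal.tendsto_ofReal hvol
    · refine (Measure.restrict_apply_le _ _).trans ?_
      change _ ≤ ENNReal.ofReal (Real.pi * ‖w‖ ^ 2)
      rw [Complex.volume_ball, ENNReal.ofReal_mul Real.pi_pos.le, ENNReal.ofReal_pow (norm_nonneg w),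
        mul_comm, ← NNReal.coe_real_pi, ENNReal.ofReal_coe_nnreal]
  have hlim : Tendsto (fun w : ℂ => ENNReal.ofReal (Real.pi * ‖w‖ ^ 2 * ‖F w‖ ^ 2))
      (𝓝[≠] 0) (𝓝 0) := by
    refine tendsto_of_tendsto_of_tendsto_of_le_of_le' tendsto_const_nhds hsmall
      (Eventually.of_forall fun _ => zero_le) ?_
    filter_upwards [nhdsWithin_le_nhds (ball_mem_nhds (0 : ℂ) (by norm_num : (0 : ℝ) < 1 / 4)),
      self_mem_nhdsWithin] with w hw hw0
    have hw' := mem_ball_zero_iff.1 hw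
    have hpos : 0 < ‖w‖ := norm_pos_iff.2 hw0
    -- The open disk of radius |w| about w avoids the origin, so F is holomorphic there. The mean
    -- value inequality then gives |w|²|F(w)|² → 0, which is Riemann's condition F = o(1/z).
    have hsub : ball w ‖w‖ ⊆ ball (0 : ℂ) (1 / 2) := by
      intro u hu
      rw [mem_ball, dist_eq_norm] at hu
      have := norm_le_norm_sub_add u w
      rw [mem_ball_zero_iff]; linarith
    have hd : DifferentiableOn ℂ F (ball w ‖w‖) := by
      refine hF.mono fun u hu => ⟨ball_subset_ball (by norm_num) (hsub hu), ?_⟩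
      rintro rfl
      simp at hu
    have := ofReal_norm_sq_le_lintegral hpos hd
    rw [← ENNReal.ofReal_mul (by positivity)] at this
    rwa [Measure.restrict_restrict measurableSet_ball, Set.inter_eq_left.2 hsub]
  have hlim2 : Tendsto (fun w : ℂ => Real.pi * ‖w‖ ^ 2 * ‖F w‖ ^ 2) (𝓝[≠] 0) (𝓝 0) := by
    have := (ENNReal.tendsto_toReal ENNReal.zero_ne_top).comp hlim
    refine this.congr fun w => ?_
    simp only [Function.comp]
    exact ENNReal.toReal_ofReal (by positivity)
  have ho1 : F =o[𝓝[≠] 0] fun z : ℂ => (z - 0)⁻¹ := by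
    rw [Asymptotics.isLittleO_iff]
    intro ε hε
    filter_upwards [hlim2.eventually (gt_mem_nhds (show 0 < Real.pi * ε ^ 2 by positivity)),
      self_mem_nhdsWithin] with w hw hw0
    have hpos : 0 < ‖w‖ := norm_pos_iff.2 hw0
    rw [sub_zero, norm_inv, ← div_eq_mul_inv, le_div_iff₀ hpos]
    refine le_of_sq_le_sq ?_ hε.le
    rw [mul_assoc, mul_lt_mul_iff_right₀ Real.pi_pos] at hw
    nlinarith
  -- The removability criterion is about F - F(0). The value F(0) is arbitrary here, but any
  -- constant is o(1/z).
  have ho2 : (fun _ : ℂ => F 0) =o[𝓝[≠] 0] fun z : ℂ => (z - 0)⁻¹ := by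
    refine Asymptotics.isLittleO_const_left.2 (Or.inr ?_)
    simp only [sub_zero]
    exact tendsto_norm_cobounded_atTop.comp (tendsto_inv₀_nhdsNE_zero)
  exact Complex.differentiableOn_update_limUnder_of_isLittleO (ball_mem_nhds 0 one_pos) hF
    (ho1.sub ho2)

/-! ### The reproducing kernel -/

lemma inner_eq_integral {α β : ℝ} {f g : Space α β 2} {F G : ℂ → ℂ} (hf : f =ᵐ[measure α β] F)
    (hg : g =ᵐ[measure α β] G) : inner ℂ g f = ∫ w, F w * conj (G w) ∂measure α β := by
  rw [Submodule.coe_inner, L2.inner_def]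
  refine integral_congr_ae ?_
  filter_upwards [hf, hg] with w h1 h2
  rw [h1, h2, RCLike.inner_apply]

lemma memLp_holo {α β : ℝ} {p : ℝ≥0∞} (f : Space α β p) : MemLp (holo f) p (measure α β) :=
  (memLp_congr_ae (ae_eq_holo f)).1 (Lp.memLp _)

lemma integrable_holo {α β : ℝ} (hα : -1 < α) (hβ : -1 < β) (f : Space α β 2) :
    Integrable (holo f) (measure α β) := by
  have := isProbabilityMeasure_measure hα hβ
  exact (memLp_holo f).integrable (by norm_num)

lemma integrable_holo_mul_conj_pow {α β : ℝ} (hα : -1 < α) (hβ : -1 < β) (f : Space α β 2)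
    (n : ℕ) : Integrable (fun w => holo f w * conj w ^ n) (measure α β) := by
  refine (integrable_holo hα hβ f).mul_bdd (c := 1) ?_ ?_
  · exact (by fun_prop : Continuous fun w : ℂ => conj w ^ n).aestronglyMeasurable
  · filter_upwards [ae_mem_ball α β] with w hw
    rw [norm_pow, RCLike.norm_conj]
    exact pow_le_one₀ (norm_nonneg w) (mem_ball_zero_iff.1 hw).le

/-- The circle averages of f(w) w̄^n are c_n |w|^{2n}; integrating them against μ produces the
moments. -/
lemma exists_coeff {α β : ℝ} (hα : -1 < α) (hβ : -1 < β) (hβ0 : β ≤ 0) (f : Space α β 2) :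
    ∃ c : ℕ → ℂ, (∀ z ∈ ball (0 : ℂ) 1, HasSum (fun n => c n * z ^ n) (holo f z)) ∧
      ∀ n, ∫ w, holo f w * conj w ^ n ∂measure α β = c n * moment α β n := by
  have := isProbabilityMeasure_measure hα hβ
  obtain ⟨c, hc1, hc2⟩ := exists_coeff_hasSum_circleAverage (differentiableOn_holo hα hβ hβ0 f)
  refine ⟨c, hc1, fun n => ?_⟩
  rw [(rotationInvariant_measure α β).integral_eq_integral_circleAverage
    (integrable_holo_mul_conj_pow hα hβ f n)]
  have : ∫ w, Real.circleAverage (fun w => holo f w * conj w ^ n) 0 ‖w‖ ∂measure α β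
      = ∫ w, c n * ((‖w‖ ^ (2 * n) : ℝ) : ℂ) ∂measure α β := by
    refine integral_congr_ae ?_
    filter_upwards [ae_mem_ball α β, ae_ne_zero α β] with w hw hw0
    rw [hc2 n ‖w‖ (norm_pos_iff.2 hw0) (mem_ball_zero_iff.1 hw)]
    push_cast; rfl
  rw [this, integral_const_mul, integral_complex_ofReal, (integrable_and_integral_norm_pow hα hβ n).2]

/-- The monomial `z ^ n` as an element of the Bergman space. -/
noncomputable def monomial {α β : ℝ} (hα : -1 < α) (hβ : -1 < β) (n : ℕ) : Space α β 2 :=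
  ofHolo (fun z => z ^ n) (by fun_prop) (memLp_of_bound hα hβ (by fun_prop) (C := 1)
    fun z hz => by
      rw [norm_pow]; exact pow_le_one₀ (norm_nonneg z) (mem_ball_zero_iff.1 hz).le)

lemma inner_monomial {α β : ℝ} (hα : -1 < α) (hβ : -1 < β) (f : Space α β 2) (n : ℕ) :
    inner ℂ (monomial hα hβ n) f = ∫ w, holo f w * conj w ^ n ∂measure α β := by
  rw [monomial, inner_eq_integral (ae_eq_holo f) (ofHolo_ae_eq _ _)]
  simp only [map_pow]

lemma eq_zero_of_holo_eq_zero {α β : ℝ} {p : ℝ≥0∞} {f : Space α β p}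
    (h : ∀ z ∈ ball (0 : ℂ) 1, holo f z = 0) : f = 0 := by
  refine Subtype.ext (Lp.ext ?_)
  refine (ae_eq_holo f).trans ?_
  refine EventuallyEq.trans ?_ (Lp.coeFn_zero ℂ p _).symm
  filter_upwards [ae_mem_ball α β] with z hz
  simpa using h z hz

lemma differentiableOn_kernel {α β : ℝ} (hα : -1 < α) (hβ : -1 < β) {z : ℂ} (hz : ‖z‖ < 1) :
    DifferentiableOn ℂ (fun w => kernel α β w z) (ball 0 1) := by
  have hr := hypergeometric_radius hα hβ
  have h1 := (FormalMultilinearSeries.hasFPowerSeriesOnBall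
    (ordinaryHypergeometricSeries ℂ (1 : ℂ) ((α : ℂ) + β + 2) ((β : ℂ) + 1))
    (by rw [hr]; exact one_pos)).differentiableOn
  refine h1.comp (by fun_prop) fun w hw => ?_
  rw [hr, mem_eball, edist_zero_right, enorm_eq_nnnorm, ← ENNReal.coe_one, ENNReal.coe_lt_coe,
    ← NNReal.coe_lt_coe]
  exact norm_mul_conj_lt_one (mem_ball_zero_iff.1 hw).le hz

lemma norm_kernel_le {α β : ℝ} (hα : -1 < α) (hβ : -1 < β) {z w : ℂ} (hz : ‖z‖ < 1)
    (hw : ‖w‖ ≤ 1) : ‖kernel α β w z‖ ≤ ∑' n, (moment α β n)⁻¹ * ‖z‖ ^ n := by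
  have h1 := hasSum_kernel hα hβ (norm_mul_conj_lt_one hw hz)
  have h2 := summable_inv_moment_mul_pow hα hβ (norm_nonneg z) hz
  rw [← h1.tsum_eq]
  refine tsum_of_norm_bounded h2.hasSum fun n => ?_
  have hm := inv_nonneg.2 (moment_pos hα hβ n).le
  rw [norm_mul, Complex.norm_real, Real.norm_of_nonneg hm, norm_pow, norm_mul, RCLike.norm_conj]
  gcongr
  exact mul_le_of_le_one_left (norm_nonneg z) hw

open Classical in
/-- The reproducing kernel at `z` as an element of the Bergman space. -/
noncomputable def kernelAt (α β : ℝ) (z : ℂ) : Space α β 2 :=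
  if h : DifferentiableOn ℂ (fun w => kernel α β w z) (ball 0 1) ∧
    MemLp (fun w => kernel α β w z) 2 (measure α β) then ofHolo _ h.1 h.2 else 0

lemma memLp_kernel {α β : ℝ} (hα : -1 < α) (hβ : -1 < β) {z : ℂ} (hz : ‖z‖ < 1) {p : ℝ≥0∞} :
    MemLp (fun w => kernel α β w z) p (measure α β) :=
  memLp_of_bound hα hβ (differentiableOn_kernel hα hβ hz).continuousOn
    fun _ hw => norm_kernel_le hα hβ hz (mem_ball_zero_iff.1 hw).le

lemma holo_kernelAt {α β : ℝ} (hα : -1 < α) (hβ : -1 < β) {z : ℂ} (hz : ‖z‖ < 1) :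
    Set.EqOn (holo (kernelAt α β z)) (fun w => kernel α β w z) (ball 0 1) := by
  rw [kernelAt, dif_pos ⟨differentiableOn_kernel hα hβ hz, memLp_kernel hα hβ hz⟩]
  exact holo_ofHolo hα hβ _ _

/-- The reproducing property. -/
lemma inner_kernelAt {α β : ℝ} (hα : -1 < α) (hβ : -1 < β) (hβ0 : β ≤ 0) (f : Space α β 2)
    {z : ℂ} (hz : ‖z‖ < 1) : inner ℂ (kernelAt α β z) f = holo f z := by
  obtain ⟨c, hc1, hc2⟩ := exists_coeff hα hβ hβ0 f
  rw [inner_eq_integral (ae_eq_holo f)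
    ((ae_eq_holo _).trans (ae_eq_of_eqOn (holo_kernelAt hα hβ hz)))]
  set F : ℕ → ℂ → ℂ := fun n w =>
    ((((moment α β n)⁻¹ : ℝ) : ℂ) * z ^ n) * (holo f w * conj w ^ n) with hF
  have hFi : ∀ n, Integrable (F n) (measure α β) := fun n =>
    (integrable_holo_mul_conj_pow hα hβ f n).const_mul _
  -- Termwise integration is allowed since |w̄^n| ≤ 1: the n-th integral is at most the n-th term of
  -- the kernel series at |z|, times the L¹ norm of f.
  have hsum : Summable fun n => ∫ w, ‖F n w‖ ∂measure α β := by
    refine Summable.of_nonneg_of_le (fun n => integral_nonneg fun _ => norm_nonneg _) (fun n => ?_)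
      ((summable_inv_moment_mul_pow hα hβ (norm_nonneg z) hz).mul_right
        (∫ w, ‖holo f w‖ ∂measure α β))
    have hm := inv_nonneg.2 (moment_pos hα hβ n).le
    rw [← integral_const_mul]
    refine integral_mono_ae (hFi n).norm ((integrable_holo hα hβ f).norm.const_mul _) ?_
    filter_upwards [ae_mem_ball α β] with w hw
    simp only [hF]
    rw [norm_mul, norm_mul, norm_mul, Complex.norm_real, Real.norm_of_nonneg hm, norm_pow,
      norm_pow, RCLike.norm_conj]
    gcongr
    exact mul_le_of_le_one_right (norm_nonneg _)
      (pow_le_one₀ (norm_nonneg w) (mem_ball_zero_iff.1 hw).le)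
  have h1 := hasSum_integral_of_summable_integral_norm hFi hsum
  have h2 : ∫ w, holo f w * conj (kernel α β w z) ∂measure α β
      = ∫ w, ∑' n, F n w ∂measure α β := by
    refine integral_congr_ae ?_
    filter_upwards [ae_mem_ball α β] with w hw
    have hk := hasSum_kernel hα hβ (norm_mul_conj_lt_one (mem_ball_zero_iff.1 hw).le hz)
    have hk2 := (Complex.hasSum_conj'.2 hk).mul_left (holo f w)
    rw [← hk2.tsum_eq]
    refine tsum_congr fun n => ?_
    simp only [hF, map_mul, map_pow, Complex.conj_ofReal, Complex.conj_conj]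
    ring
  rw [h2]
  refine h1.unique ?_
  have hfun : (fun n => ∫ w, F n w ∂measure α β) = fun n => c n * z ^ n := by
    funext n
    simp only [hF]
    rw [integral_const_mul, hc2]
    have : (moment α β n : ℂ) ≠ 0 := by exact_mod_cast (moment_pos hα hβ n).ne'
    push_cast
    field_simp
  rw [hfun]
  exact hc1 z (mem_ball_zero_iff.2 hz)

/-- The reproducing property applied to the kernel itself gives ‖K_z‖² = K(z, z). -/
lemma norm_kernelAt_sq {α β : ℝ} (hα : -1 < α) (hβ : -1 < β) (hβ0 : β ≤ 0) {z : ℂ}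
    (hz : ‖z‖ < 1) :
    HasSum (fun n => (moment α β n)⁻¹ * (‖z‖ ^ 2) ^ n) (‖kernelAt α β z‖ ^ 2) := by
  have h1 := inner_kernelAt hα hβ hβ0 (kernelAt α β z) hz
  rw [holo_kernelAt hα hβ hz (mem_ball_zero_iff.2 hz)] at h1
  have h2 := hasSum_kernel hα hβ (norm_mul_conj_lt_one hz.le hz)
  simp only at h1
  rw [← h1, inner_self_eq_norm_sq_to_K (𝕜 := ℂ) (kernelAt α β z), Complex.mul_conj,
    Complex.normSq_eq_norm_sq] at h2
  have h3 := Complex.hasSum_re h2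
  convert h3 using 1
  · funext n
    rw [← Complex.ofReal_pow, ← Complex.ofReal_mul, Complex.ofReal_re]
  · norm_cast

/-- Every coefficient of K(z, z) is at least 1, because the moments are at most 1. The resulting
blow-up at the boundary is what makes the normalized kernels weakly null. -/
lemma inv_one_sub_le_norm_kernelAt_sq {α β : ℝ} (hα : -1 < α) (hβ : -1 < β) (hβ0 : β ≤ 0) {z : ℂ}
    (hz : ‖z‖ < 1) : (1 - ‖z‖ ^ 2)⁻¹ ≤ ‖kernelAt α β z‖ ^ 2 := by
  refine hasSum_le (fun n => ?_) (hasSum_geometric_of_lt_one (sq_nonneg ‖z‖)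
    (by nlinarith [norm_nonneg z])) (norm_kernelAt_sq hα hβ hβ0 hz)
  exact le_mul_of_one_le_left (by positivity) (one_le_inv_moment hα hβ n)

lemma kernelAt_ne_zero {α β : ℝ} (hα : -1 < α) (hβ : -1 < β) (hβ0 : β ≤ 0) {z : ℂ}
    (hz : ‖z‖ < 1) : 0 < ‖kernelAt α β z‖ := by
  have h1 := inv_one_sub_le_norm_kernelAt_sq hα hβ hβ0 hz
  have h2 : 0 < (1 - ‖z‖ ^ 2)⁻¹ := inv_pos.2 (by nlinarith [norm_nonneg z])
  refine (norm_nonneg _).lt_of_ne fun h => ?_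
  rw [← h] at h1
  nlinarith

/-- The kernels are bounded on compact subsets of the disk. -/
lemma exists_norm_kernelAt_le {α β : ℝ} (hα : -1 < α) (hβ : -1 < β) (hβ0 : β ≤ 0) {r : ℝ}
    (h1 : r < 1) : ∃ C : ℝ, ∀ z : ℂ, ‖z‖ ≤ r → ‖kernelAt α β z‖ ≤ C := by
  by_cases h0 : 0 ≤ r
  · refine ⟨√(∑' n, (moment α β n)⁻¹ * (r ^ 2) ^ n), fun z hz => Real.le_sqrt_of_sq_le ?_⟩
    have hz1 := hz.trans_lt h1
    rw [← (norm_kernelAt_sq hα hβ hβ0 hz1).tsum_eq]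
    refine Summable.tsum_le_tsum (fun n => ?_) (norm_kernelAt_sq hα hβ hβ0 hz1).summable
      (summable_inv_moment_mul_pow hα hβ (sq_nonneg r) (by nlinarith))
    have hm := inv_nonneg.2 (moment_pos hα hβ n).le
    gcongr
  · exact ⟨0, fun z hz => absurd ((norm_nonneg z).trans hz) h0⟩

lemma norm_holo_le {α β : ℝ} (hα : -1 < α) (hβ : -1 < β) (hβ0 : β ≤ 0) (f : Space α β 2)
    {z : ℂ} (hz : ‖z‖ < 1) : ‖holo f z‖ ≤ ‖kernelAt α β z‖ * ‖f‖ := by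
  rw [← inner_kernelAt hα hβ hβ0 f hz]
  exact norm_inner_le_norm (kernelAt α β z) f

/-- The Bergman space is complete. -/
lemma isClosed_space {α β : ℝ} (hα : -1 < α) (hβ : -1 < β) (hβ0 : β ≤ 0) :
    IsClosed (Space α β 2 : Set (Lp ℂ 2 (measure α β))) := by
  refine IsSeqClosed.isClosed fun f x hf hx => ?_
  -- The limit x is not yet known to have a holomorphic representative; pairing it with the kernels
  -- supplies the candidate.
  set F : ℂ → ℂ := fun z => inner ℂ (kernelAt α β z : Lp ℂ 2 (measure α β)) x with hFdef
  have hbound : ∀ n, ∀ z : ℂ, ‖z‖ < 1 →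
      ‖F z - holo (⟨f n, hf n⟩ : Space α β 2) z‖ ≤ ‖kernelAt α β z‖ * ‖x - f n‖ := by
    intro n z hz
    rw [← inner_kernelAt hα hβ hβ0 _ hz, Submodule.coe_inner, hFdef, ← inner_sub_right]
    exact norm_inner_le_norm (𝕜 := ℂ) _ _
  have hx0 : Tendsto (fun n => ‖x - f n‖) atTop (𝓝 0) := by
    have := (tendsto_iff_norm_sub_tendsto_zero.1 hx)
    simpa only [norm_sub_rev] using this
  have hloc : TendstoLocallyUniformlyOn (fun n => holo (⟨f n, hf n⟩ : Space α β 2)) F atTop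
      (ball 0 1) := by
    rw [Metric.tendstoLocallyUniformlyOn_iff]
    intro ε hε z hz
    obtain ⟨r, hr1, hr2⟩ := exists_between (mem_ball_zero_iff.1 hz)
    obtain ⟨C, hC⟩ := exists_norm_kernelAt_le hα hβ hβ0 hr2
    refine ⟨ball 0 r, nhdsWithin_le_nhds (isOpen_ball.mem_nhds (mem_ball_zero_iff.2 hr1)), ?_⟩
    have h1 : Tendsto (fun n => C * ‖x - f n‖) atTop (𝓝 0) := by simpa using hx0.const_mul C
    filter_upwards [h1.eventually (gt_mem_nhds hε)] with n hn y hy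
    have hy' := mem_ball_zero_iff.1 hy
    rw [dist_eq_norm]
    refine (hbound n y (hy'.trans hr2)).trans_lt (lt_of_le_of_lt ?_ hn)
    gcongr
    exact hC y hy'.le
  have hFd : DifferentiableOn ℂ F (ball 0 1) :=
    hloc.differentiableOn (Eventually.of_forall fun n => differentiableOn_holo hα hβ hβ0 _)
      isOpen_ball
  refine ⟨F, hFd.mono Set.sdiff_subset, ?_⟩
  -- L² convergence gives convergence almost everywhere along a subsequence, which identifies x with
  -- F.
  obtain ⟨ns, hns, hae⟩ := (tendstoInMeasure_of_tendsto_Lp hx).exists_seq_tendsto_ae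
  have hall : ∀ᵐ z ∂measure α β, ∀ n, f n z = holo (⟨f n, hf n⟩ : Space α β 2) z :=
    ae_all_iff.2 fun n => ae_eq_holo (⟨f n, hf n⟩ : Space α β 2)
  filter_upwards [hae, hall, ae_mem_ball α β] with z h1 h2 hz
  refine tendsto_nhds_unique h1 ?_
  simp only [h2]
  exact (hloc.tendsto_at hz).comp hns.tendsto_atTop

lemma completeSpace_space {α β : ℝ} (hα : -1 < α) (hβ : -1 < β) (hβ0 : β ≤ 0) :
    CompleteSpace (Space α β 2) :=
  (isClosed_space hα hβ hβ0).completeSpace_coe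

lemma eq_zero_of_inner_monomial {α β : ℝ} (hα : -1 < α) (hβ : -1 < β) (hβ0 : β ≤ 0)
    {f : Space α β 2} (h : ∀ n, inner ℂ (monomial hα hβ n) f = 0) : f = 0 := by
  obtain ⟨c, hc1, hc2⟩ := exists_coeff hα hβ hβ0 f
  have hc0 : ∀ n, c n = 0 := fun n => by
    have h1 := h n
    rw [inner_monomial, hc2] at h1
    have : (moment α β n : ℂ) ≠ 0 := by exact_mod_cast (moment_pos hα hβ n).ne'
    exact (mul_eq_zero.1 h1).resolve_right this
  refine eq_zero_of_holo_eq_zero fun z hz => (hc1 z hz).unique ?_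
  simp [hc0]

lemma dense_span_monomial {α β : ℝ} (hα : -1 < α) (hβ : -1 < β) (hβ0 : β ≤ 0) :
    (Submodule.span ℂ (Set.range (monomial hα hβ))).topologicalClosure = ⊤ := by
  have := completeSpace_space hα hβ hβ0
  rw [Submodule.topologicalClosure_eq_top_iff, Submodule.eq_bot_iff]
  intro f hf
  refine eq_zero_of_inner_monomial hα hβ hβ0 fun n => ?_
  exact (Submodule.mem_orthogonal _ _).1 hf _ (Submodule.subset_span ⟨n, rfl⟩)

/-! ### Compact operators and weakly null families -/

section Hilbert

variable {H : Type*} [NormedAddCommGroup H] [InnerProductSpace ℂ H]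

lemma eq_of_mapClusterPt_of_tendsto {X ι : Type*} [TopologicalSpace X] [T2Space X] {l : Filter ι}
    {u : ι → X} {x y : X} (hx : MapClusterPt x l u) (hy : Tendsto u l (𝓝 y)) : x = y := by
  have : (𝓝 x ⊓ 𝓝 y).NeBot := ClusterPt.mono hx hy
  exact eq_of_nhds_neBot this

/-- A compact operator maps bounded weakly null families to norm null families. -/
lemma tendsto_zero_of_isCompactOperator [CompleteSpace H] {T : H →L[ℂ] H}
    (hT : IsCompactOperator T) {ι : Type*} {l : Filter ι} {k : ι → H} {C : ℝ}
    (hk : ∀ i, ‖k i‖ ≤ C) (hw : ∀ h : H, Tendsto (fun i => inner ℂ h (k i)) l (𝓝 0)) :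
    Tendsto (fun i => T (k i)) l (𝓝 0) := by
  obtain ⟨K, hK, hTK⟩ := hT.image_closedBall_subset_compact C
  -- The images stay in a compact set, so it suffices that 0 is their only cluster point. A cluster
  -- point is tested weakly, with T moved to the other side as its adjoint.
  refine hK.tendsto_nhds_of_unique_mapClusterPt (Eventually.of_forall fun i =>
    hTK ⟨k i, mem_closedBall_zero_iff.2 (hk i), rfl⟩) fun g _ hg => ?_
  refine ext_inner_left ℂ fun h => ?_
  have h1 : MapClusterPt (inner ℂ h g) l ((fun x => inner ℂ h x) ∘ fun i => T (k i)) :=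
    hg.continuousAt_comp (by fun_prop)
  have h2 : Tendsto ((fun x => inner ℂ h x) ∘ fun i => T (k i)) l (𝓝 0) := by
    refine (hw (ContinuousLinearMap.adjoint T h)).congr fun i => ?_
    rw [ContinuousLinearMap.adjoint_inner_left]; rfl
  rw [eq_of_mapClusterPt_of_tendsto h1 h2, inner_zero_right]

/-- To check that a bounded family is weakly null it suffices to test on a total set. -/
lemma tendsto_inner_of_dense_span {s : Set H} (hs : (Submodule.span ℂ s).topologicalClosure = ⊤)
    {ι : Type*} {l : Filter ι} {k : ι → H} (hk : ∀ i, ‖k i‖ ≤ 1)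
    (hw : ∀ h ∈ s, Tendsto (fun i => inner ℂ h (k i)) l (𝓝 0)) (h : H) :
    Tendsto (fun i => inner ℂ h (k i)) l (𝓝 0) := by
  have hspan : ∀ g ∈ Submodule.span ℂ s, Tendsto (fun i => inner ℂ g (k i)) l (𝓝 0) := by
    intro g hg
    induction hg using Submodule.span_induction with
    | mem x hx => exact hw x hx
    | zero => simpa using tendsto_const_nhds
    | add x y _ _ hx hy => simpa [inner_add_left] using hx.add hy
    | smul a x _ hx => simpa [inner_smul_left, mul_comm] using hx.const_mul (conj a)
  rw [Metric.tendsto_nhds]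
  intro ε hε
  have hmem : h ∈ closure (Submodule.span ℂ s : Set H) := by
    rw [← Submodule.topologicalClosure_coe, hs]; trivial
  obtain ⟨g, hg, hgd⟩ := Metric.mem_closure_iff.1 hmem (ε / 2) (by positivity)
  filter_upwards [Metric.tendsto_nhds.1 (hspan g hg) (ε / 2) (by positivity)] with i hi
  rw [dist_zero_right] at hi ⊢
  rw [dist_eq_norm] at hgd
  calc ‖inner ℂ h (k i)‖ = ‖inner ℂ (h - g) (k i) + inner ℂ g (k i)‖ := by
        rw [← inner_add_left, sub_add_cancel]
    _ ≤ ‖inner ℂ (h - g) (k i)‖ + ‖inner ℂ g (k i)‖ := norm_add_le _ _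
    _ ≤ ‖h - g‖ * ‖k i‖ + ‖inner ℂ g (k i)‖ := by gcongr; exact norm_inner_le_norm _ _
    _ ≤ ‖h - g‖ * 1 + ‖inner ℂ g (k i)‖ := by gcongr; exact hk i
    _ < ε := by linarith

end Hilbert

/-! ### The Berezin transform of a compact Toeplitz operator -/

/-- The normalized kernel as an element of the Bergman space. -/
noncomputable def unitKernel (α β : ℝ) (z : ℂ) : Space α β 2 :=
  ((‖kernelAt α β z‖⁻¹ : ℝ) : ℂ) • kernelAt α β z

/-- An inequality is stated so that it holds at every index z, also off the disk or where the kernel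
vector is 0; `tendsto_zero_of_isCompactOperator` needs such a bound. -/
lemma norm_unitKernel_le (α β : ℝ) (z : ℂ) : ‖unitKernel α β z‖ ≤ 1 := by
  rw [unitKernel, norm_smul, Complex.norm_real, norm_inv, norm_norm]
  exact inv_mul_le_one

lemma sqrt_integral_norm_kernel_sq {α β : ℝ} (hα : -1 < α) (hβ : -1 < β) {z : ℂ}
    (hz : ‖z‖ < 1) : √(∫ u, ‖kernel α β u z‖ ^ 2 ∂measure α β) = ‖kernelAt α β z‖ := by
  have hae := (ae_eq_holo (kernelAt α β z)).trans (ae_eq_of_eqOn (holo_kernelAt hα hβ hz))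
  have h1 := inner_eq_integral hae hae
  rw [inner_self_eq_norm_sq_to_K (𝕜 := ℂ) (kernelAt α β z)] at h1
  simp only [Complex.mul_conj, Complex.normSq_eq_norm_sq] at h1
  rw [integral_complex_ofReal] at h1
  have h2 : ‖kernelAt α β z‖ ^ 2 = ∫ u, ‖kernel α β u z‖ ^ 2 ∂measure α β :=
    Complex.ofReal_injective ((Complex.ofReal_pow _ _).trans h1)
  rw [← h2, Real.sqrt_sq (norm_nonneg _)]

/-- `holo` rests on a choice and is not linear by definition; linearity comes from writing
evaluation as an inner product. -/
lemma holo_smul {α β : ℝ} (hα : -1 < α) (hβ : -1 < β) (hβ0 : β ≤ 0) (c : ℂ) (f : Space α β 2)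
    {z : ℂ} (hz : ‖z‖ < 1) : holo (c • f) z = c * holo f z := by
  rw [← inner_kernelAt hα hβ hβ0 _ hz, ← inner_kernelAt hα hβ hβ0 _ hz]
  exact inner_smul_right (kernelAt α β z) f c

lemma holo_add {α β : ℝ} (hα : -1 < α) (hβ : -1 < β) (hβ0 : β ≤ 0) (f g : Space α β 2)
    {z : ℂ} (hz : ‖z‖ < 1) : holo (f + g) z = holo f z + holo g z := by
  rw [← inner_kernelAt hα hβ hβ0 _ hz, ← inner_kernelAt hα hβ hβ0 _ hz,
    ← inner_kernelAt hα hβ hβ0 _ hz]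
  exact inner_add_right (kernelAt α β z) f g

lemma holo_unitKernel {α β : ℝ} (hα : -1 < α) (hβ : -1 < β) (hβ0 : β ≤ 0) {z w : ℂ}
    (hz : ‖z‖ < 1) (hw : ‖w‖ < 1) : holo (unitKernel α β z) w = normalizedKernel α β z w := by
  rw [unitKernel, holo_smul hα hβ hβ0 _ _ hw, holo_kernelAt hα hβ hz (mem_ball_zero_iff.2 hw),
    normalizedKernel, sqrt_integral_norm_kernel_sq hα hβ hz, Complex.ofReal_inv, div_eq_inv_mul]

lemma inner_unitKernel {α β : ℝ} (hα : -1 < α) (hβ : -1 < β) (hβ0 : β ≤ 0) (f : Space α β 2)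
    {z : ℂ} (hz : ‖z‖ < 1) :
    inner ℂ (unitKernel α β z) f = ((‖kernelAt α β z‖⁻¹ : ℝ) : ℂ) * holo f z := by
  rw [← inner_kernelAt hα hβ hβ0 f hz]
  refine (inner_smul_left (kernelAt α β z) f _).trans ?_
  rw [Complex.conj_ofReal]

/-- By density only monomials need testing, and |⟨z^n, k^z⟩| = |z|^n / ‖K_z‖ ≤ √(1-|z|²). -/
lemma tendsto_inner_unitKernel {α β : ℝ} (hα : -1 < α) (hβ : -1 < β) (hβ0 : β ≤ 0)
    (h : Space α β 2) :
    Tendsto (fun z => inner ℂ h (unitKernel α β z)) (comap (fun z : ℂ => ‖z‖) (𝓝[<] 1)) (𝓝 0) := by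
  refine tendsto_inner_of_dense_span (dense_span_monomial hα hβ hβ0) (norm_unitKernel_le α β) ?_ h
  rintro _ ⟨n, rfl⟩
  have hl : Tendsto (fun z : ℂ => ‖z‖) (comap (fun z : ℂ => ‖z‖) (𝓝[<] 1)) (𝓝[<] 1) :=
    tendsto_comap
  have hlim : Tendsto (fun z : ℂ => √(1 - ‖z‖ ^ 2)) (comap (fun z : ℂ => ‖z‖) (𝓝[<] 1)) (𝓝 0) := by
    have : Continuous fun t : ℝ => √(1 - t ^ 2) := by fun_prop
    have h1 := (this.tendsto 1).comp (hl.mono_right nhdsWithin_le_nhds)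
    simpa [Function.comp_def] using h1
  refine squeeze_zero_norm' ?_ hlim
  filter_upwards [hl.eventually self_mem_nhdsWithin] with z (hz : ‖z‖ < 1)
  have hK := kernelAt_ne_zero hα hβ hβ0 hz
  have hpos : 0 < 1 - ‖z‖ ^ 2 := by nlinarith [norm_nonneg z]
  have h1 : ‖inner ℂ (monomial hα hβ n) (unitKernel α β z)‖ ≤ ‖kernelAt α β z‖⁻¹ := by
    rw [norm_inner_symm (monomial hα hβ n) (unitKernel α β z), inner_unitKernel hα hβ hβ0 _ hz,
      monomial, holo_ofHolo hα hβ _ _ (mem_ball_zero_iff.2 hz), norm_mul,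
      Complex.norm_real, norm_inv, norm_norm, norm_pow]
    exact mul_le_of_le_one_right (by positivity) (pow_le_one₀ (norm_nonneg z) hz.le)
  refine h1.trans (Real.le_sqrt_of_sq_le ?_)
  rw [inv_pow, inv_le_comm₀ (by positivity) hpos]
  exact inv_one_sub_le_norm_kernelAt_sq hα hβ hβ0 hz

lemma ae_mem_ball_of_measure_compl {ν : Measure ℂ} (hν : ν (ball (0 : ℂ) 1)ᶜ = 0) :
    ∀ᵐ z ∂ν, z ∈ ball (0 : ℂ) 1 := by
  rw [ae_iff]; exact hν

lemma berezin_eq_inner {α β : ℝ} (hα : -1 < α) (hβ : -1 < β) (hβ0 : β ≤ 0) {ν : Measure ℂ}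
    (hν : ν (ball (0 : ℂ) 1)ᶜ = 0) {T : Space α β 2 →L[ℂ] Space α β 2} (hT : IsToeplitz ν T)
    {z : ℂ} (hz : ‖z‖ < 1) :
    berezin α β ν z = inner ℂ (unitKernel α β z) (T (unitKernel α β z)) := by
  have hk : unitKernel α β z =ᵐ[measure α β] normalizedKernel α β z :=
    (ae_eq_holo _).trans (ae_eq_of_eqOn fun w hw =>
      holo_unitKernel hα hβ hβ0 hz (mem_ball_zero_iff.1 hw))
  rw [inner_eq_integral (ae_eq_holo _) hk, berezin]
  refine integral_congr_ae ?_
  filter_upwards [ae_mem_ball α β] with u hu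
  rw [(hT (unitKernel α β z) u hu).2]
  congr 1
  refine integral_congr_ae ?_
  filter_upwards [ae_mem_ball_of_measure_compl hν] with w hw
  rw [holo_unitKernel hα hβ hβ0 hz (mem_ball_zero_iff.1 hw)]

/-- Pairing with k^z is evaluation at z divided by ‖K_z‖, so the outer integral disappears by the
reproducing property and no Fubini theorem is needed. -/
lemma berezin_eq_integral {α β : ℝ} (hα : -1 < α) (hβ : -1 < β) (hβ0 : β ≤ 0) {ν : Measure ℂ}
    (hν : ν (ball (0 : ℂ) 1)ᶜ = 0) {T : Space α β 2 →L[ℂ] Space α β 2} (hT : IsToeplitz ν T)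
    {z : ℂ} (hz : ‖z‖ < 1) :
    berezin α β ν z = ((∫ w, ‖normalizedKernel α β z w‖ ^ 2 ∂ν : ℝ) : ℂ) := by
  rw [berezin_eq_inner hα hβ hβ0 hν hT hz, inner_unitKernel hα hβ hβ0 _ hz,
    (hT (unitKernel α β z) z (mem_ball_zero_iff.2 hz)).2, toeplitz, ← integral_const_mul,
    ← integral_complex_ofReal]
  refine integral_congr_ae ?_
  filter_upwards [ae_mem_ball_of_measure_compl hν] with w hw
  rw [holo_unitKernel hα hβ hβ0 hz (mem_ball_zero_iff.1 hw), ← Complex.normSq_eq_norm_sq,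
    ← Complex.mul_conj]
  conv_rhs => rw [normalizedKernel, map_div₀, Complex.conj_ofReal,
    sqrt_integral_norm_kernel_sq hα hβ hz]
  rw [normalizedKernel, sqrt_integral_norm_kernel_sq hα hβ hz]
  push_cast
  ring

theorem berezin_of_toeplitzCompact {α β : ℝ} (hα : -1 < α) (hβ : -1 < β) (hβ0 : β ≤ 0)
    {ν : Measure ℂ} (hν : ν (ball (0 : ℂ) 1)ᶜ = 0) (h : ToeplitzCompact α β ν) :
    (∀ z ∈ ball (0 : ℂ) 1, berezin α β ν z =
        ((∫ w, ‖normalizedKernel α β z w‖ ^ 2 ∂ν : ℝ) : ℂ)) ∧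
      Tendsto (berezin α β ν) (comap (fun z : ℂ => ‖z‖) (𝓝[<] 1)) (𝓝 0) := by
  have := completeSpace_space hα hβ hβ0
  obtain ⟨T, hT, hTc⟩ := h
  refine ⟨fun z hz => berezin_eq_integral hα hβ hβ0 hν hT (mem_ball_zero_iff.1 hz), ?_⟩
  have h1 := (tendsto_zero_of_isCompactOperator hTc (norm_unitKernel_le α β)
    (tendsto_inner_unitKernel hα hβ hβ0)).norm
  rw [norm_zero] at h1
  refine squeeze_zero_norm' ?_ h1
  have hl : Tendsto (fun z : ℂ => ‖z‖) (comap (fun z : ℂ => ‖z‖) (𝓝[<] 1)) (𝓝[<] 1) :=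
    tendsto_comap
  filter_upwards [hl.eventually self_mem_nhdsWithin] with z (hz : ‖z‖ < 1)
  rw [berezin_eq_inner hα hβ hβ0 hν hT hz]
  refine (norm_inner_le_norm (unitKernel α β z) _).trans ?_
  exact mul_le_of_le_one_left (norm_nonneg _) (norm_unitKernel_le α β z)

/-! ### Test functions -/

/-- The test functions `(1 - |u|²)^s (1 - ū w)^{-N}`. -/
noncomputable def testFun (N : ℕ) (s : ℝ) (u w : ℂ) : ℂ :=
  (((1 - ‖u‖ ^ 2) ^ s : ℝ) : ℂ) * ((1 - conj u * w)⁻¹) ^ N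

lemma one_sub_conj_mul_ne_zero {u w : ℂ} (hu : ‖u‖ < 1) (hw : ‖w‖ ≤ 1) : 1 - conj u * w ≠ 0 := by
  rw [← norm_pos_iff]
  refine lt_of_lt_of_le ?_ norm_one_sub_conj_mul_ge
  nlinarith [norm_nonneg u, norm_nonneg w]

lemma norm_testFun {N : ℕ} {s : ℝ} {u : ℂ} (hu : ‖u‖ < 1) (w : ℂ) :
    ‖testFun N s u w‖ = (1 - ‖u‖ ^ 2) ^ s * (‖1 - conj u * w‖ ^ N)⁻¹ := by
  have : 0 < 1 - ‖u‖ ^ 2 := by nlinarith [norm_nonneg u]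
  rw [testFun, norm_mul, Complex.norm_real, Real.norm_of_nonneg (by positivity), norm_pow, norm_inv,
    inv_pow]

lemma norm_testFun_le {N : ℕ} {s : ℝ} {u w : ℂ} (hu : ‖u‖ < 1) {r : ℝ} (hr : r < 1)
    (hw : ‖w‖ ≤ r) : ‖testFun N s u w‖ ≤ (1 - ‖u‖ ^ 2) ^ s * ((1 - r) ^ N)⁻¹ := by
  have h0 : 0 < 1 - ‖u‖ ^ 2 := by nlinarith [norm_nonneg u]
  have h1 : 0 < 1 - r := by linarith
  have h2 : 1 - r ≤ ‖1 - conj u * w‖ := by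
    refine le_trans ?_ norm_one_sub_conj_mul_ge
    nlinarith [norm_nonneg u, norm_nonneg w]
  rw [norm_testFun hu]
  gcongr

lemma differentiableOn_testFun {N : ℕ} {s : ℝ} {u : ℂ} (hu : ‖u‖ < 1) :
    DifferentiableOn ℂ (testFun N s u) (ball 0 1) := by
  intro w hw
  have h1 : DifferentiableAt ℂ (fun w : ℂ => 1 - conj u * w) w := by fun_prop
  exact (((h1.inv (one_sub_conj_mul_ne_zero hu (mem_ball_zero_iff.1 hw).le)).pow N).const_mul
    _).differentiableWithinAt

lemma memLp_testFun {α β : ℝ} (hα : -1 < α) (hβ : -1 < β) {p : ℝ≥0∞} {N : ℕ} {s : ℝ} {u : ℂ}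
    (hu : ‖u‖ < 1) : MemLp (testFun N s u) p (measure α β) := by
  have h0 : 0 < 1 - ‖u‖ ^ 2 := by nlinarith [norm_nonneg u]
  have h1 : 0 < 1 - ‖u‖ := by linarith
  refine memLp_of_bound hα hβ (differentiableOn_testFun hu).continuousOn
    (C := (1 - ‖u‖ ^ 2) ^ s * ((1 - ‖u‖) ^ N)⁻¹) fun w hw => ?_
  have hw' := mem_ball_zero_iff.1 hw
  have h2 : 1 - ‖u‖ ≤ ‖1 - conj u * w‖ := by
    refine le_trans ?_ norm_one_sub_conj_mul_ge
    nlinarith [norm_nonneg u, norm_nonneg w]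
  rw [norm_testFun hu]
  gcongr

/-- The test functions as elements of the Bergman space. -/
noncomputable def test {α β : ℝ} (hα : -1 < α) (hβ : -1 < β) (p : ℝ≥0∞) (N : ℕ) (s : ℝ) {u : ℂ}
    (hu : ‖u‖ < 1) : Space α β p :=
  ofHolo (testFun N s u) (differentiableOn_testFun hu) (memLp_testFun hα hβ hu)

/-- The exponent N - (α+2)/P is chosen so that, after raising to the power P, it cancels the growth
in the Forelli–Rudin estimate with T = NP; the bound is uniform in u. -/
lemma integral_norm_testFun_rpow_le {α β : ℝ} (hα : -1 < α) (hβ : -1 < β) (hβ0 : β ≤ 0) {P : ℝ}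
    (hP : 0 < P) {N : ℕ} (hN : α + 3 ≤ N * P) {u : ℂ} (hu : ‖u‖ < 1) :
    ∫ w, ‖testFun N (N - (α + 2) / P) u w‖ ^ P ∂measure α β ≤ 2 ^ (N * P - 2) := by
  have h0 : 0 < 1 - ‖u‖ ^ 2 := by nlinarith [norm_nonneg u]
  calc ∫ w, ‖testFun N (N - (α + 2) / P) u w‖ ^ P ∂measure α β
      = ∫ w, (1 - ‖u‖ ^ 2) ^ (N * P - (α + 2)) * ‖1 - conj u * w‖ ^ (-(N * P))
          ∂measure α β := by
        refine integral_congr_ae (Eventually.of_forall fun w => ?_)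
        simp only
        rw [norm_testFun hu, Real.mul_rpow (by positivity) (by positivity), ← Real.rpow_mul h0.le,
          Real.inv_rpow (by positivity), ← Real.rpow_natCast ‖1 - conj u * w‖ N,
          ← Real.rpow_mul (norm_nonneg _), Real.rpow_neg (norm_nonneg _)]
        congr 2
        field_simp
    _ = (1 - ‖u‖ ^ 2) ^ (N * P - (α + 2)) * ∫ w, ‖1 - conj u * w‖ ^ (-(N * P)) ∂measure α β :=
        integral_const_mul _ _
    _ ≤ (1 - ‖u‖ ^ 2) ^ (N * P - (α + 2)) *
          (2 ^ (N * P - 2) * (1 - ‖u‖ ^ 2) ^ (α + 2 - N * P)) := by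
        gcongr
        exact integral_norm_one_sub_mul_rpow_le hα hβ hβ0 hu hN
    _ = 2 ^ (N * P - 2) * (1 - ‖u‖ ^ 2) ^ ((N * P - (α + 2)) + (α + 2 - N * P)) := by
        rw [Real.rpow_add h0]; ring
    _ = 2 ^ (N * P - 2) := by
        rw [show (N * P - (α + 2)) + (α + 2 - N * P) = 0 by ring, Real.rpow_zero, mul_one]

lemma norm_test_le {α β : ℝ} (hα : -1 < α) (hβ : -1 < β) (hβ0 : β ≤ 0) {p : ℝ≥0∞}
    [hp1 : Fact (1 ≤ p)] (hp : p ≠ ∞) {N : ℕ} (hN : α + 3 ≤ N * p.toReal) {u : ℂ}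
    (hu : ‖u‖ < 1) :
    ‖test hα hβ p N (N - (α + 2) / p.toReal) hu‖ ≤ (2 ^ (N * p.toReal - 2)) ^ p.toReal⁻¹ := by
  have hp0 : p ≠ 0 := (one_pos.trans_le hp1.out).ne'
  have hP : 0 < p.toReal := ENNReal.toReal_pos hp0 hp
  have hm := memLp_testFun hα hβ (p := p) (N := N) (s := N - (α + 2) / p.toReal) hu
  change ‖hm.toLp _‖ ≤ _
  rw [Lp.norm_toLp, hm.eLpNorm_eq_integral_rpow_norm hp0 hp, ENNReal.toReal_ofReal (by positivity)]
  gcongr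
  exact integral_norm_testFun_rpow_le hα hβ hβ0 hP hN hu

lemma tendsto_one_sub_norm_sq_rpow {u : ℕ → ℂ} (h1 : Tendsto (fun n => ‖u n‖) atTop (𝓝 1)) {s : ℝ}
    (hs : 0 < s) : Tendsto (fun n => (1 - ‖u n‖ ^ 2) ^ s) atTop (𝓝 0) := by
  have : Continuous fun t : ℝ => (1 - t ^ 2) ^ s :=
    (by fun_prop : Continuous fun t : ℝ => 1 - t ^ 2).rpow_const fun _ => Or.inr hs.le
  simpa [Function.comp_def, Real.zero_rpow hs.ne'] using (this.tendsto 1).comp h1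

lemma tendsto_testFun {u : ℕ → ℂ} (hu : ∀ n, ‖u n‖ < 1) (h1 : Tendsto (fun n => ‖u n‖) atTop (𝓝 1))
    {N : ℕ} {s : ℝ} (hs : 0 < s) {w : ℂ} (hw : ‖w‖ < 1) :
    Tendsto (fun n => testFun N s (u n) w) atTop (𝓝 0) := by
  refine squeeze_zero_norm (fun n => norm_testFun_le (hu n) hw le_rfl) ?_
  simpa using (tendsto_one_sub_norm_sq_rpow h1 hs).mul_const _

/-- Where |g| ≤ ε the uniform L¹ bound suffices. The remaining set lies in a smaller disk, where the
test functions tend to 0 uniformly. -/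
lemma weakStarNull_test {α β : ℝ} (hα : -1 < α) (hβ : -1 < β) (hβ0 : β ≤ 0) {N : ℕ}
    (hN : α + 3 ≤ N) {u : ℕ → ℂ} (hu : ∀ n, ‖u n‖ < 1)
    (h1 : Tendsto (fun n => ‖u n‖) atTop (𝓝 1)) :
    WeakStarNull fun n => test hα hβ 1 N (N - (α + 2)) (hu n) := by
  have := isProbabilityMeasure_measure hα hβ
  intro g hg hg0
  obtain ⟨M, hM⟩ := (isCompact_closedBall (0 : ℂ) 1).exists_bound_of_continuousOn hg.continuousOn
  have hM0 : 0 ≤ M := (norm_nonneg _).trans (hM 0 (by simp))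
  set C : ℝ := 2 ^ ((N : ℝ) - 2) with hC
  have hbound : ∀ ε > 0, ∃ D, ∀ n, ‖∫ z, holo (test hα hβ 1 N (N - (α + 2)) (hu n)) z * g z
      ∂measure α β‖ ≤ ε * C + D * (1 - ‖u n‖ ^ 2) ^ ((N : ℝ) - (α + 2)) := by
    intro ε hε
    have hclosed : IsClosed {z | ε ≤ ‖g z‖} := isClosed_le continuous_const (by fun_prop)
    have hsub : {z | ε ≤ ‖g z‖} ⊆ ball (0 : ℂ) 1 := by
      intro z hz
      rw [mem_ball_zero_iff]
      by_contra hz1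
      have : ε ≤ ‖g z‖ := hz
      rw [hg0 z (not_lt.1 hz1), norm_zero] at this
      linarith
    obtain ⟨r, hr, hrs⟩ := exists_lt_subset_ball hclosed hsub
    have hr' : 0 < 1 - r := by linarith
    refine ⟨((1 - r) ^ N)⁻¹ * M, fun n => ?_⟩
    set δ := (1 - ‖u n‖ ^ 2) ^ ((N : ℝ) - (α + 2)) with hδ
    have hδ0 : 0 ≤ δ := by
      have : 0 < 1 - ‖u n‖ ^ 2 := by nlinarith [norm_nonneg (u n), hu n]
      positivity
    have hint : Integrable (fun w => ‖testFun N (N - (α + 2)) (u n) w‖) (measure α β) :=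
      (memLp_one_iff_integrable.1 (memLp_testFun hα hβ (hu n))).norm
    have hI : ∫ w, ‖testFun N (N - (α + 2)) (u n) w‖ ∂measure α β ≤ C := by
      have := integral_norm_testFun_rpow_le hα hβ hβ0 one_pos (N := N) (by linarith) (hu n)
      simpa only [div_one, Real.rpow_one, mul_one] using this
    calc _ ≤ ∫ w, (ε * ‖testFun N (N - (α + 2)) (u n) w‖ + ((1 - r) ^ N)⁻¹ * M * δ)
          ∂measure α β := by
          refine norm_integral_le_of_norm_le ((hint.const_mul _).add (integrable_const _)) ?_
          filter_upwards [ae_mem_ball α β] with w hw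
          rw [test, holo_ofHolo hα hβ _ _ hw, norm_mul]
          by_cases hwε : ‖g w‖ ≤ ε
          · have : 0 ≤ ((1 - r) ^ N)⁻¹ * M * δ := by positivity
            nlinarith [norm_nonneg (testFun N (N - (α + 2)) (u n) w)]
          · have hwr := hrs (show ε ≤ ‖g w‖ from (not_le.1 hwε).le)
            have h2 := norm_testFun_le (N := N) (s := N - (α + 2)) (hu n) hr
              (mem_ball_zero_iff.1 hwr).le
            have h3 := hM w (mem_closedBall_zero_iff.2 (mem_ball_zero_iff.1 hw).le)
            calc _ ≤ (δ * ((1 - r) ^ N)⁻¹) * M := by gcongr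
              _ ≤ _ := by
                have : 0 ≤ ε * ‖testFun N (N - (α + 2)) (u n) w‖ := by positivity
                linarith
      _ = ε * ∫ w, ‖testFun N (N - (α + 2)) (u n) w‖ ∂measure α β + ((1 - r) ^ N)⁻¹ * M * δ := by
          rw [integral_add (hint.const_mul _) (integrable_const _), integral_const_mul]
          simp
      _ ≤ _ := by gcongr
  have hlim := tendsto_one_sub_norm_sq_rpow h1 (s := (N : ℝ) - (α + 2)) (by linarith)
  rw [Metric.tendsto_nhds]
  intro ε hε
  have hC0 : 0 < C := by positivity
  obtain ⟨D, hD⟩ := hbound (ε / (2 * C)) (by positivity)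
  have h2 : Tendsto (fun n => D * (1 - ‖u n‖ ^ 2) ^ ((N : ℝ) - (α + 2))) atTop (𝓝 0) := by
    simpa using hlim.const_mul D
  filter_upwards [h2.eventually (gt_mem_nhds (show 0 < ε / 2 by positivity))] with n hn
  rw [dist_zero_right]
  refine (hD n).trans_lt ?_
  have : ε / (2 * C) * C = ε / 2 := by field_simp
  linarith

/-! ### Decay of a vanishing Carleson measure near the boundary -/

/-- The constant 1 belongs to the space, hence to L^p(ν). -/
lemma isFiniteMeasure_of_isInclusion {α β : ℝ} (hα : -1 < α) (hβ : -1 < β) {p : ℝ≥0∞}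
    [hp1 : Fact (1 ≤ p)] (hp : p ≠ ∞) {ν : Measure ℂ} (hν : ν (ball (0 : ℂ) 1)ᶜ = 0)
    {i : Space α β p →ₗ[ℂ] Lp ℂ p ν} (hi : IsInclusion i) : IsFiniteMeasure ν := by
  have hp0 : p ≠ 0 := (one_pos.trans_le hp1.out).ne'
  set e : Space α β p := ofHolo (fun _ => 1) (differentiableOn_const 1)
    (memLp_of_bound hα hβ continuousOn_const (C := 1) (by simp)) with he
  have h1 : i e =ᵐ[ν] fun _ => (1 : ℂ) := by
    filter_upwards [(hi e).2, ae_mem_ball_of_measure_compl hν] with z hz hzb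
    rw [hz, he, holo_ofHolo hα hβ _ _ hzb]
  have h2 : MemLp (fun _ : ℂ => (1 : ℂ)) p ν := (memLp_congr_ae h1).1 (Lp.memLp _)
  rw [memLp_const_iff hp0 hp] at h2
  exact ⟨by simpa using h2⟩

lemma inclusion_test_ae_eq {α β : ℝ} (hα : -1 < α) (hβ : -1 < β) {p : ℝ≥0∞} {ν : Measure ℂ}
    (hν : ν (ball (0 : ℂ) 1)ᶜ = 0) {i : Space α β p →ₗ[ℂ] Lp ℂ p ν} (hi : IsInclusion i)
    {N : ℕ} {s : ℝ} {u : ℂ} (hu : ‖u‖ < 1) :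
    i (test hα hβ p N s hu) =ᵐ[ν] testFun N s u := by
  filter_upwards [(hi _).2, ae_mem_ball_of_measure_compl hν] with z hz hzb
  rw [hz, test, holo_ofHolo hα hβ _ _ hzb]

/-- If p = 1 this is the hypothesis, applied to a weak-star null sequence. If p > 1 the images lie
in a compact set; a cluster point is the ν-almost everywhere limit of a subsequence, hence 0 because
the test functions tend to 0 pointwise. No weak convergence in 𝒜^p is needed. -/
lemma tendsto_norm_inclusion_test {α β : ℝ} (hα : -1 < α) (hβ : -1 < β) (hβ0 : β ≤ 0) {p : ℝ≥0∞}
    [hp1 : Fact (1 ≤ p)] (hp : p ≠ ∞) {ν : Measure ℂ} (hν : ν (ball (0 : ℂ) 1)ᶜ = 0)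
    {i : Space α β p →ₗ[ℂ] Lp ℂ p ν} (hi : IsInclusion i)
    (hc : 1 < p → IsCompactOperator i)
    (hw : p = 1 → ∀ f : ℕ → Space α β p, WeakStarNull f → Tendsto (fun n => ‖i (f n)‖) atTop (𝓝 0))
    {N : ℕ} (hN : α + 3 ≤ N * p.toReal) {u : ℕ → ℂ} (hu : ∀ n, ‖u n‖ < 1)
    (h1 : Tendsto (fun n => ‖u n‖) atTop (𝓝 1)) :
    Tendsto (fun n => ‖i (test hα hβ p N (N - (α + 2) / p.toReal) (hu n))‖) atTop (𝓝 0) := by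
  have hp0 : p ≠ 0 := (one_pos.trans_le hp1.out).ne'
  have hP : 0 < p.toReal := ENNReal.toReal_pos hp0 hp
  rcases hp1.out.eq_or_lt with h | h
  · subst h
    refine hw rfl _ ?_
    simp only [ENNReal.toReal_one, mul_one, div_one] at hN ⊢
    exact weakStarNull_test hα hβ hβ0 hN hu h1
  · have hs : 0 < N - (α + 2) / p.toReal := by
      rw [sub_pos, div_lt_iff₀ hP]; linarith
    obtain ⟨K, hK, hTK⟩ := (hc h).image_closedBall_subset_compact
      ((2 ^ (N * p.toReal - 2)) ^ p.toReal⁻¹)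
    suffices Tendsto (fun n => i (test hα hβ p N (N - (α + 2) / p.toReal) (hu n))) atTop (𝓝 0) by
      simpa using this.norm
    refine hK.tendsto_nhds_of_unique_mapClusterPt (Eventually.of_forall fun n =>
      hTK ⟨_, mem_closedBall_zero_iff.2 (norm_test_le hα hβ hβ0 hp hN (hu n)), rfl⟩)
      fun g _ hg => ?_
    obtain ⟨ψ, hψ, hlim⟩ := hg.tendsto_subseq
    obtain ⟨φ, hφ, hae⟩ := (tendstoInMeasure_of_tendsto_Lp hlim).exists_seq_tendsto_ae
    have hall : ∀ᵐ z ∂ν, ∀ n, i (test hα hβ p N (N - (α + 2) / p.toReal) (hu n)) z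
        = testFun N (N - (α + 2) / p.toReal) (u n) z :=
      ae_all_iff.2 fun n => inclusion_test_ae_eq hα hβ hν hi (hu n)
    refine Lp.ext (EventuallyEq.trans ?_ (Lp.coeFn_zero ℂ p ν).symm)
    filter_upwards [hae, hall, ae_mem_ball_of_measure_compl hν] with z hz1 hz2 hz
    refine tendsto_nhds_unique hz1 ?_
    simp only [Function.comp, hz2]
    exact (tendsto_testFun hu h1 hs (mem_ball_zero_iff.1 hz)).comp
      (hψ.tendsto_atTop.comp hφ.tendsto_atTop)

/-- Chebyshev's inequality. With δ = 1 - |u|², on the ball |1-ūw| ≤ 2δ, so the p-th power of the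
test function is at least c = 2^{-Np} δ^{-(α+2)} there. -/
lemma measure_ball_le {α β : ℝ} (hα : -1 < α) (hβ : -1 < β) {p : ℝ≥0∞}
    [hp1 : Fact (1 ≤ p)] (hp : p ≠ ∞) {ν : Measure ℂ} (hν : ν (ball (0 : ℂ) 1)ᶜ = 0)
    {i : Space α β p →ₗ[ℂ] Lp ℂ p ν} (hi : IsInclusion i) (N : ℕ) {u : ℂ} (hu : ‖u‖ < 1) :
    ν (ball u ((1 - ‖u‖) / 3)) ≤ ENNReal.ofReal
      (2 ^ (N * p.toReal) * ‖i (test hα hβ p N (N - (α + 2) / p.toReal) hu)‖ ^ p.toReal *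
        (1 - ‖u‖ ^ 2) ^ (α + 2)) := by
  have hp0 : p ≠ 0 := (one_pos.trans_le hp1.out).ne'
  have hP : 0 < p.toReal := ENNReal.toReal_pos hp0 hp
  set δ := 1 - ‖u‖ ^ 2 with hδ
  have hδ0 : 0 < δ := by simp only [hδ]; nlinarith [norm_nonneg u]
  set x := i (test hα hβ p N (N - (α + 2) / p.toReal) hu) with hx
  set c : ℝ := (2 ^ (N * p.toReal) * δ ^ (α + 2))⁻¹ with hc
  have hc0 : 0 < c := by positivity
  have hcheb := mul_meas_ge_le_pow_eLpNorm ν hp0 hp (Lp.aestronglyMeasurable x) (ENNReal.ofReal c)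
  have hnorm : eLpNorm x p ν ^ p.toReal = ENNReal.ofReal (‖x‖ ^ p.toReal) := by
    rw [← ENNReal.ofReal_rpow_of_nonneg (norm_nonneg x) hP.le, Lp.norm_def,
      ENNReal.ofReal_toReal (Lp.eLpNorm_ne_top x)]
  have hsub : ν (ball u ((1 - ‖u‖) / 3)) ≤ ν {z | ENNReal.ofReal c ≤ ‖x z‖ₑ ^ p.toReal} := by
    refine measure_mono_ae ?_
    filter_upwards [inclusion_test_ae_eq hα hβ hν hi (N := N) (s := N - (α + 2) / p.toReal) hu,
      ae_mem_ball_of_measure_compl hν] with w hw hwb hwu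
    have hwu' : ‖w - u‖ < (1 - ‖u‖) / 3 := by
      rw [← dist_eq_norm]; exact hwu
    change ENNReal.ofReal c ≤ ‖x w‖ₑ ^ p.toReal
    rw [hx, hw, ← ofReal_norm, ENNReal.ofReal_rpow_of_nonneg (norm_nonneg _) hP.le]
    refine ENNReal.ofReal_le_ofReal ?_
    have hpos : 0 < ‖1 - conj u * w‖ :=
      norm_pos_iff.2 (one_sub_conj_mul_ne_zero hu (mem_ball_zero_iff.1 hwb).le)
    have hle : ‖1 - conj u * w‖ ≤ 2 * δ := by
      -- Expanding about w = u gives 1 - |u|² as the main term; the rest is at most |w - u| <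
      -- (1-|u|)/3 ≤ δ.
      have e : 1 - conj u * w = ((δ : ℝ) : ℂ) - conj u * (w - u) := by
        have : conj u * u = ((‖u‖ ^ 2 : ℝ) : ℂ) := by
          rw [mul_comm, Complex.mul_conj, Complex.normSq_eq_norm_sq]
        rw [mul_sub, this, hδ]; push_cast; ring
      rw [e]
      refine (norm_sub_le _ _).trans ?_
      rw [Complex.norm_real, Real.norm_of_nonneg hδ0.le, norm_mul, RCLike.norm_conj]
      have h3 : ‖u‖ * ‖w - u‖ ≤ ‖w - u‖ := mul_le_of_le_one_left (norm_nonneg _) hu.le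
      have h4 : 1 - ‖u‖ ≤ δ := by simp only [hδ]; nlinarith [norm_nonneg u]
      linarith
    rw [norm_testFun hu, Real.mul_rpow (by positivity) (by positivity), ← Real.rpow_mul hδ0.le,
      Real.inv_rpow (by positivity), ← Real.rpow_natCast, ← Real.rpow_mul (norm_nonneg _)]
    have h5 : ‖1 - conj u * w‖ ^ (N * p.toReal) ≤ 2 ^ (N * p.toReal) * δ ^ (N * p.toReal) := by
      rw [← Real.mul_rpow two_pos.le hδ0.le]
      exact Real.rpow_le_rpow hpos.le hle (by positivity)
    calc c = δ ^ ((N - (α + 2) / p.toReal) * p.toReal) *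
          (2 ^ (N * p.toReal) * δ ^ (N * p.toReal))⁻¹ := by
          rw [hc, sub_mul, div_mul_cancel₀ _ hP.ne', Real.rpow_sub hδ0]
          have := Real.rpow_pos_of_pos hδ0 (N * p.toReal)
          field_simp
      _ ≤ _ := by gcongr
  rw [hnorm] at hcheb
  calc ν (ball u ((1 - ‖u‖) / 3)) ≤ ν {z | ENNReal.ofReal c ≤ ‖x z‖ₑ ^ p.toReal} := hsub
    _ ≤ (ENNReal.ofReal c)⁻¹ * ENNReal.ofReal (‖x‖ ^ p.toReal) := by
        exact (ENNReal.mul_le_iff_le_inv (by simpa using hc0) ENNReal.ofReal_ne_top).1 hcheb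
    _ = _ := by
        rw [← ENNReal.ofReal_inv_of_pos hc0, ← ENNReal.ofReal_mul (by positivity), hc, inv_inv]
        congr 1; ring

/-- A vanishing Carleson measure is small on hyperbolic disks near the boundary. -/
lemma IsVanishingCarleson.exists_radius {α β : ℝ} (hα : -1 < α) (hβ : -1 < β) (hβ0 : β ≤ 0)
    {p : ℝ≥0∞} [hp1 : Fact (1 ≤ p)] (hp : p ≠ ∞) {ν : Measure ℂ}
    (hν : ν (ball (0 : ℂ) 1)ᶜ = 0) (h : IsVanishingCarleson α β p ν) {ε : ℝ} (hε : 0 < ε) :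
    ∃ r < 1, ∀ u : ℂ, r ≤ ‖u‖ → ‖u‖ < 1 →
      ν (ball u ((1 - ‖u‖) / 3)) ≤ ENNReal.ofReal (ε * (1 - ‖u‖ ^ 2) ^ (α + 2)) := by
  obtain ⟨i, hi, hc, hw⟩ := h
  have hp0 : p ≠ 0 := (one_pos.trans_le hp1.out).ne'
  have hP : 0 < p.toReal := ENNReal.toReal_pos hp0 hp
  -- Np ≥ α + 3 is what the Forelli–Rudin estimate asks for; it also makes the exponent N - (α+2)/p
  -- positive.
  obtain ⟨N, hN⟩ := exists_nat_ge ((α + 3) / p.toReal)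
  rw [div_le_iff₀ hP] at hN
  by_contra! hcon
  have hlt : ∀ n : ℕ, 1 - 1 / ((n : ℝ) + 1) < 1 := fun n => by
    have : 0 < 1 / ((n : ℝ) + 1) := by positivity
    linarith
  choose u hu1 hu2 hu3 using fun n : ℕ => hcon _ (hlt n)
  have hu : Tendsto (fun n => ‖u n‖) atTop (𝓝 1) := by
    refine tendsto_of_tendsto_of_tendsto_of_le_of_le ?_ tendsto_const_nhds hu1
      (fun n => (hu2 n).le)
    simpa using (tendsto_one_div_add_atTop_nhds_zero_nat (𝕜 := ℝ)).const_sub 1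
  have hlim := tendsto_norm_inclusion_test hα hβ hβ0 hp hν hi hc hw hN hu2 hu
  have hlim2 : Tendsto (fun n => 2 ^ (N * p.toReal) *
      ‖i (test hα hβ p N (N - (α + 2) / p.toReal) (hu2 n))‖ ^ p.toReal) atTop (𝓝 0) := by
    simpa [Real.zero_rpow hP.ne'] using
      (hlim.rpow_const (Or.inr hP.le)).const_mul (2 ^ (N * p.toReal))
  obtain ⟨n, hn⟩ := (hlim2.eventually (gt_mem_nhds hε)).exists
  refine absurd ((measure_ball_le hα hβ hp hν hi N (hu2 n)).trans
    (ENNReal.ofReal_le_ofReal ?_)) (not_le.2 (hu3 n))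
  have : 0 < 1 - ‖u n‖ ^ 2 := by nlinarith [norm_nonneg (u n), hu2 n]
  gcongr

/-! ### The Carleson embedding -/

lemma measurableSet_annulus (r : ℝ) : MeasurableSet {w : ℂ | r < ‖w‖ ∧ ‖w‖ < 1} :=
  ((isOpen_lt continuous_const continuous_norm).inter
    (isOpen_lt continuous_norm continuous_const)).measurableSet

/-- The inner integral left after Tonelli in `lintegral_annulus_le`: u is fixed and w runs over the
centres whose averaging disk contains u. These centres lie in one disk about u, to which the
hypothesis applies. -/
lemma lintegral_indicator_le {α β : ℝ} (hα : -1 < α) (hβ : -1 < β) (hβ0 : β ≤ 0) {ν : Measure ℂ}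
    {ε r : ℝ} (hε : 0 ≤ ε) (hr0 : 0 ≤ r)
    (h : ∀ u : ℂ, r ≤ ‖u‖ → ‖u‖ < 1 →
      ν (ball u ((1 - ‖u‖) / 3)) ≤ ENNReal.ofReal (ε * (1 - ‖u‖ ^ 2) ^ (α + 2)))
    {u : ℂ} (hu : ‖u‖ < 1) :
    ∫⁻ w in {w | 1 - 4 / 5 * (1 - r) < ‖w‖ ∧ ‖w‖ < 1},
        (ball w ((1 - ‖w‖) / 4)).indicator
          (fun _ => (ENNReal.ofReal (Real.pi * ((1 - ‖w‖) / 4) ^ 2))⁻¹) u ∂ν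
      ≤ ENNReal.ofReal (100 * ProbabilityTheory.beta (α + 1) (β + 1) * ε) *
        ENNReal.ofReal (density α β u) := by
  have hB := ProbabilityTheory.beta_pos (α := α + 1) (β := β + 1) (by linarith) (by linarith)
  have hpi := Real.pi_pos
  set b := 1 - ‖u‖ with hb
  have hb0 : 0 < b := by simp only [hb]; linarith
  -- From |u-w| < (1-|w|)/4 follows (3/4)(1-|w|) < 1-|u| < (5/4)(1-|w|). The lower bound gives the
  -- radius (1-|u|)/3; the upper one gives the factor 4/5, also used in the inner radius of the
  -- annulus to force |u| > r.
  have hgeom : ∀ w : ℂ, 1 - 4 / 5 * (1 - r) < ‖w‖ → u ∈ ball w ((1 - ‖w‖) / 4) →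
      r < ‖u‖ ∧ w ∈ ball u (b / 3) ∧ 4 / 5 * b ≤ 1 - ‖w‖ := by
    intro w hw huw
    rw [mem_ball, dist_eq_norm] at huw ⊢
    have h1 := norm_sub_norm_le u w
    have h2 := norm_sub_norm_le w u
    rw [norm_sub_rev w u] at h2 ⊢
    refine ⟨by linarith, ?_, ?_⟩ <;> simp only [hb] <;> linarith
  by_cases hur : r < ‖u‖
  swap
  · refine le_trans (setLIntegral_mono' (measurableSet_annulus _) (g := 0) fun w hw => ?_)
      (by simp)
    rw [Set.indicator_of_notMem fun huw => hur (hgeom w hw.1 huw).1]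
    exact zero_le
  have hδ0 : 0 < 1 - ‖u‖ ^ 2 := by nlinarith [norm_nonneg u]
  calc _ ≤ ∫⁻ w in {w | 1 - 4 / 5 * (1 - r) < ‖w‖ ∧ ‖w‖ < 1}, (ball u (b / 3)).indicator
        (fun _ => (ENNReal.ofReal (Real.pi * (b / 5) ^ 2))⁻¹) w ∂ν := by
        refine setLIntegral_mono' (measurableSet_annulus _) fun w hw => ?_
        by_cases huw : u ∈ ball w ((1 - ‖w‖) / 4)
        · obtain ⟨-, h2, h3⟩ := hgeom w hw.1 huw
          rw [Set.indicator_of_mem huw, Set.indicator_of_mem h2, ENNReal.inv_le_inv]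
          refine ENNReal.ofReal_le_ofReal ?_
          have : b / 5 ≤ (1 - ‖w‖) / 4 := by linarith
          gcongr
        · rw [Set.indicator_of_notMem huw]; exact zero_le
    _ ≤ ∫⁻ w, (ball u (b / 3)).indicator
        (fun _ => (ENNReal.ofReal (Real.pi * (b / 5) ^ 2))⁻¹) w ∂ν :=
        lintegral_mono' Measure.restrict_le_self le_rfl
    _ = (ENNReal.ofReal (Real.pi * (b / 5) ^ 2))⁻¹ * ν (ball u (b / 3)) :=
        lintegral_indicator_const measurableSet_ball _
    _ ≤ (ENNReal.ofReal (Real.pi * (b / 5) ^ 2))⁻¹ *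
          ENNReal.ofReal (ε * (1 - ‖u‖ ^ 2) ^ (α + 2)) := by
        gcongr
        exact h u hur.le hu
    _ ≤ _ := by
        rw [← ENNReal.ofReal_inv_of_pos (by positivity), ← ENNReal.ofReal_mul (by positivity),
          ← ENNReal.ofReal_mul (by positivity)]
        refine ENNReal.ofReal_le_ofReal ?_
        have h1 : 1 ≤ ‖u‖ ^ (2 * β) :=
          Real.one_le_rpow_of_pos_of_le_one_of_nonpos (by linarith) hu.le (by linarith)
        have h2 : (1 - ‖u‖ ^ 2) ^ 2 ≤ 4 * b ^ 2 := by
          have : 1 - ‖u‖ ^ 2 ≤ 2 * b := by simp only [hb]; nlinarith [sq_nonneg (1 - ‖u‖)]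
          nlinarith
        rw [density, Real.rpow_add hδ0, Real.rpow_two]
        have h3 : 0 < (1 - ‖u‖ ^ 2) ^ α := by positivity
        -- The constant 100 is 25 · 4: 25 from (b/5)^{-2} and 4 from (1-|u|²)² ≤ 4b². The beta value
        -- compensates the normalization of the density.
        calc (Real.pi * (b / 5) ^ 2)⁻¹ * (ε * ((1 - ‖u‖ ^ 2) ^ α * (1 - ‖u‖ ^ 2) ^ 2))
            ≤ (Real.pi * (b / 5) ^ 2)⁻¹ * (ε * ((1 - ‖u‖ ^ 2) ^ α * (4 * b ^ 2))) := by gcongr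
          _ = 100 * ε * (1 * (1 - ‖u‖ ^ 2) ^ α) / Real.pi := by field_simp; ring
          _ ≤ 100 * ε * (‖u‖ ^ (2 * β) * (1 - ‖u‖ ^ 2) ^ α) / Real.pi := by gcongr
          _ = _ := by field_simp

/-- The Carleson estimate near the boundary, for functions holomorphic on the disk. -/
lemma lintegral_annulus_le {α β : ℝ} (hα : -1 < α) (hβ : -1 < β) (hβ0 : β ≤ 0) {ν : Measure ℂ}
    [IsFiniteMeasure ν] {ε r : ℝ} (hε : 0 ≤ ε) (hr0 : 0 ≤ r)
    (h : ∀ u : ℂ, r ≤ ‖u‖ → ‖u‖ < 1 →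
      ν (ball u ((1 - ‖u‖) / 3)) ≤ ENNReal.ofReal (ε * (1 - ‖u‖ ^ 2) ^ (α + 2)))
    {F : ℂ → ℂ} (hF : DifferentiableOn ℂ F (ball 0 1)) :
    ∫⁻ w in {w | 1 - 4 / 5 * (1 - r) < ‖w‖ ∧ ‖w‖ < 1}, ENNReal.ofReal (‖F w‖ ^ 2) ∂ν
      ≤ ENNReal.ofReal (100 * ProbabilityTheory.beta (α + 1) (β + 1) * ε) *
        ∫⁻ u, ENNReal.ofReal (‖F u‖ ^ 2) ∂measure α β := by
  classical
  set S := {w : ℂ | 1 - 4 / 5 * (1 - r) < ‖w‖ ∧ ‖w‖ < 1} with hS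
  -- Off the disk F is arbitrary; cutting it off there makes the integrand measurable on the plane,
  -- as Tonelli requires.
  set φ : ℂ → ℝ≥0∞ := (ball (0 : ℂ) 1).piecewise (fun u => ENNReal.ofReal (‖F u‖ ^ 2)) 0 with hφ
  have hφm : Measurable φ := by
    refine ContinuousOn.measurable_piecewise ?_ continuousOn_const measurableSet_ball
    exact ENNReal.continuous_ofReal.comp_continuousOn (hF.continuousOn.norm.pow 2)
  set k : ℂ → ℂ → ℝ≥0∞ := fun w u => (ball w ((1 - ‖w‖) / 4)).indicator
    (fun _ => (ENNReal.ofReal (Real.pi * ((1 - ‖w‖) / 4) ^ 2))⁻¹) u with hk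
  have hkm : Measurable (Function.uncurry k) := by
    have hset : MeasurableSet {q : ℂ × ℂ | dist q.2 q.1 < (1 - ‖q.1‖) / 4} :=
      (isOpen_lt (by fun_prop) (by fun_prop)).measurableSet
    have hfun : Measurable fun q : ℂ × ℂ =>
        (ENNReal.ofReal (Real.pi * ((1 - ‖q.1‖) / 4) ^ 2))⁻¹ := by fun_prop
    exact hfun.indicator hset
  have hpt : ∀ w ∈ S, ENNReal.ofReal (‖F w‖ ^ 2) ≤ ∫⁻ u, k w u * φ u := by
    intro w hw
    have hR : 0 < (1 - ‖w‖) / 4 := by linarith [hw.2]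
    have hsub : ball w ((1 - ‖w‖) / 4) ⊆ ball 0 1 := by
      refine ball_subset_ball' ?_
      rw [dist_zero_right]; linarith
    have h1 := ofReal_norm_sq_le_lintegral hR (hF.mono hsub)
    rw [ENNReal.mul_le_iff_le_inv (by simpa using by positivity) ENNReal.ofReal_ne_top] at h1
    refine h1.trans (le_of_eq ?_)
    rw [← lintegral_const_mul' _ _ (by simpa using by positivity),
      ← lintegral_indicator measurableSet_ball]
    refine lintegral_congr fun u => ?_
    by_cases hu : u ∈ ball w ((1 - ‖w‖) / 4)
    · simp only [hk, hφ, Set.indicator_of_mem hu, Set.piecewise_eq_of_mem _ _ _ (hsub hu)]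
    · simp only [hk, Set.indicator_of_notMem hu, zero_mul]
  calc ∫⁻ w in S, ENNReal.ofReal (‖F w‖ ^ 2) ∂ν
      ≤ ∫⁻ w in S, (∫⁻ u, k w u * φ u) ∂ν := setLIntegral_mono' (measurableSet_annulus _) hpt
    _ = ∫⁻ u, ∫⁻ w in S, k w u * φ u ∂ν :=
        lintegral_lintegral_swap (hkm.mul (hφm.comp measurable_snd)).aemeasurable
    _ = ∫⁻ u, (∫⁻ w in S, k w u ∂ν) * φ u := by
        refine lintegral_congr fun u => lintegral_mul_const _ ?_
        exact hkm.comp (measurable_id.prodMk measurable_const)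
    _ ≤ ∫⁻ u, ENNReal.ofReal (100 * ProbabilityTheory.beta (α + 1) (β + 1) * ε) *
          ((ball (0 : ℂ) 1).indicator (fun u => ENNReal.ofReal (density α β u) * φ u) u) := by
        refine lintegral_mono fun u => ?_
        by_cases hu : u ∈ ball (0 : ℂ) 1
        · rw [Set.indicator_of_mem hu, ← mul_assoc]
          gcongr
          exact lintegral_indicator_le hα hβ hβ0 hε hr0 h (mem_ball_zero_iff.1 hu)
        · rw [Set.indicator_of_notMem hu,
            show φ u = 0 from Set.piecewise_eq_of_notMem _ _ _ hu, mul_zero, mul_zero]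
    _ = ENNReal.ofReal (100 * ProbabilityTheory.beta (α + 1) (β + 1) * ε) *
          ∫⁻ u in ball (0 : ℂ) 1, ENNReal.ofReal (density α β u) * φ u := by
        rw [lintegral_const_mul' _ _ ENNReal.ofReal_ne_top, lintegral_indicator measurableSet_ball]
    _ = ENNReal.ofReal (100 * ProbabilityTheory.beta (α + 1) (β + 1) * ε) *
          ∫⁻ u, φ u ∂measure α β := by
        rw [measure, lintegral_withDensity_eq_lintegral_mul _ (measurable_ofReal_density α β) hφm]
        rfl
    _ = _ := by
        congr 1
        refine lintegral_congr_ae ?_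
        filter_upwards [ae_mem_ball α β] with u hu
        simp only [hφ, Set.piecewise_eq_of_mem _ _ _ hu]

lemma lintegral_norm_sq_eq {ν : Measure ℂ} (x : Lp ℂ 2 ν) :
    ∫⁻ w, ENNReal.ofReal (‖x w‖ ^ 2) ∂ν = ENNReal.ofReal (‖x‖ ^ 2) := by
  have h1 : inner ℂ x x = ∫ w, ((‖x w‖ ^ 2 : ℝ) : ℂ) ∂ν := by
    rw [L2.inner_def]
    refine integral_congr_ae (Eventually.of_forall fun w => ?_)
    simp only [RCLike.inner_apply, Complex.mul_conj, Complex.normSq_eq_norm_sq]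
  rw [inner_self_eq_norm_sq_to_K (𝕜 := ℂ) x, integral_complex_ofReal] at h1
  have h2 : ‖x‖ ^ 2 = ∫ w, ‖x w‖ ^ 2 ∂ν :=
    Complex.ofReal_injective ((Complex.ofReal_pow _ _).trans h1)
  rw [h2, ofReal_integral_eq_lintegral_ofReal
    ((memLp_two_iff_integrable_sq_norm (Lp.aestronglyMeasurable x)).1 (Lp.memLp x))
    (Eventually.of_forall fun _ => by positivity)]

/-- The measures for which the embedding estimate holds with arbitrarily small constant, up to a
bound on a compact subset of the disk. -/
def SmallEmbedding (α β : ℝ) (ν : Measure ℂ) : Prop :=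
  ∀ ε > 0, ∃ r < 1, ∀ (f : Space α β 2) (B : ℝ), (∀ w : ℂ, ‖w‖ ≤ r → ‖holo f w‖ ≤ B) →
    ∫⁻ w, ENNReal.ofReal (‖holo f w‖ ^ 2) ∂ν
      ≤ ENNReal.ofReal (ε * ‖f‖ ^ 2 + B ^ 2 * ν.real Set.univ)

/-- On the boundary annulus `lintegral_annulus_le` applies; on the complementary disk the integrand
is at most B² and ν is finite. -/
lemma IsVanishingCarleson.smallEmbedding {α β : ℝ} (hα : -1 < α) (hβ : -1 < β) (hβ0 : β ≤ 0)
    {p : ℝ≥0∞} [hp1 : Fact (1 ≤ p)] (hp : p ≠ ∞) {ν : Measure ℂ} [IsFiniteMeasure ν]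
    (hν : ν (ball (0 : ℂ) 1)ᶜ = 0) (h : IsVanishingCarleson α β p ν) : SmallEmbedding α β ν := by
  have hB := ProbabilityTheory.beta_pos (α := α + 1) (β := β + 1) (by linarith) (by linarith)
  intro ε hε
  obtain ⟨r, hr, hru⟩ := h.exists_radius hα hβ hβ0 hp hν
    (ε := ε / (100 * ProbabilityTheory.beta (α + 1) (β + 1))) (by positivity)
  -- The radius may come out negative, while the annulus estimate needs r ≥ 0.
  have hmax : max r 0 < 1 := max_lt hr one_pos
  refine ⟨1 - 4 / 5 * (1 - max r 0), by linarith, fun f B hfB => ?_⟩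
  have h1 := lintegral_annulus_le hα hβ hβ0 (r := max r 0) (by positivity) (le_max_right _ _)
    (fun u hu => hru u ((le_max_left _ _).trans hu)) (differentiableOn_holo hα hβ hβ0 f)
  rw [mul_div_cancel₀ _ (by positivity)] at h1
  have h2 : ∫⁻ u, ENNReal.ofReal (‖holo f u‖ ^ 2) ∂measure α β = ENNReal.ofReal (‖f‖ ^ 2) := by
    refine Eq.trans ?_ (lintegral_norm_sq_eq (f : Lp ℂ 2 (measure α β)))
    refine lintegral_congr_ae ?_
    filter_upwards [ae_eq_holo f] with u hu
    rw [hu]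
  rw [h2, ← ENNReal.ofReal_mul hε.le] at h1
  set S := {w : ℂ | 1 - 4 / 5 * (1 - max r 0) < ‖w‖ ∧ ‖w‖ < 1} with hS
  rw [← lintegral_add_compl _ (measurableSet_annulus (1 - 4 / 5 * (1 - max r 0))),
    ENNReal.ofReal_add (by positivity) (by positivity)]
  refine add_le_add h1 ?_
  calc ∫⁻ w in Sᶜ, ENNReal.ofReal (‖holo f w‖ ^ 2) ∂ν
      ≤ ∫⁻ _ in Sᶜ, ENNReal.ofReal (B ^ 2) ∂ν := by
        refine lintegral_mono_ae ?_
        filter_upwards [ae_restrict_mem (measurableSet_annulus _).compl,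
          ae_restrict_of_ae (ae_mem_ball_of_measure_compl hν)] with w hw hwb
        have hw1 : ‖w‖ ≤ 1 - 4 / 5 * (1 - max r 0) := by
          by_contra hcon
          exact hw ⟨not_le.1 hcon, mem_ball_zero_iff.1 hwb⟩
        refine ENNReal.ofReal_le_ofReal ?_
        gcongr
        exact hfB w hw1
    _ ≤ ∫⁻ _, ENNReal.ofReal (B ^ 2) ∂ν := lintegral_mono' Measure.restrict_le_self le_rfl
    _ = _ := by
        rw [lintegral_const, ENNReal.ofReal_mul (by positivity), Measure.real,
          ENNReal.ofReal_toReal (measure_ne_top ν _)]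

lemma aestronglyMeasurable_of_differentiableOn {ν : Measure ℂ} (hν : ν (ball (0 : ℂ) 1)ᶜ = 0)
    {G : ℂ → ℂ} (hG : DifferentiableOn ℂ G (ball 0 1)) : AEStronglyMeasurable G ν := by
  rw [← Measure.restrict_eq_self_of_ae_mem (ae_mem_ball_of_measure_compl hν)]
  exact hG.continuousOn.aestronglyMeasurable measurableSet_ball

/-- A bound for the embedding in `L²(ν)`. -/
lemma SmallEmbedding.exists_bound {α β : ℝ} (hα : -1 < α) (hβ : -1 < β) (hβ0 : β ≤ 0)
    {ν : Measure ℂ} (h : SmallEmbedding α β ν) :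
    ∃ C : ℝ, 0 ≤ C ∧ ∀ f : Space α β 2,
      ∫⁻ w, ENNReal.ofReal (‖holo f w‖ ^ 2) ∂ν ≤ ENNReal.ofReal (C * ‖f‖ ^ 2) := by
  -- For boundedness any ε will do; the supremum on the smaller disk is then bounded through point
  -- evaluations by a multiple of ‖f‖.
  obtain ⟨r, hr, hf⟩ := h 1 one_pos
  obtain ⟨D, hD⟩ := exists_norm_kernelAt_le hα hβ hβ0 hr
  refine ⟨1 + D ^ 2 * ν.real Set.univ, by positivity, fun f => ?_⟩
  refine (hf f (D * ‖f‖) fun w hw => ?_).trans (ENNReal.ofReal_le_ofReal (le_of_eq (by ring)))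
  refine (norm_holo_le hα hβ hβ0 f (hw.trans_lt hr)).trans ?_
  gcongr
  exact hD w hw

lemma memLp_holo_of_lintegral {α β : ℝ} (hα : -1 < α) (hβ : -1 < β) (hβ0 : β ≤ 0) {ν : Measure ℂ}
    (hν : ν (ball (0 : ℂ) 1)ᶜ = 0) {f : Space α β 2} {C : ℝ}
    (h : ∫⁻ w, ENNReal.ofReal (‖holo f w‖ ^ 2) ∂ν ≤ ENNReal.ofReal C) : MemLp (holo f) 2 ν := by
  have hm := aestronglyMeasurable_of_differentiableOn hν (differentiableOn_holo hα hβ hβ0 f)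
  refine (memLp_two_iff_integrable_sq_norm hm).2 ⟨(hm.norm.pow 2), ?_⟩
  rw [hasFiniteIntegral_iff_ofReal (Eventually.of_forall fun _ => by positivity)]
  exact h.trans_lt ENNReal.ofReal_lt_top

/-- The inclusion of `𝒜²_{α,β}` in `L²(ν)` as a bounded operator. -/
lemma SmallEmbedding.exists_inclusion {α β : ℝ} (hα : -1 < α) (hβ : -1 < β) (hβ0 : β ≤ 0)
    {ν : Measure ℂ} (hν : ν (ball (0 : ℂ) 1)ᶜ = 0) (h : SmallEmbedding α β ν) :
    ∃ ι : Space α β 2 →L[ℂ] Lp ℂ 2 ν, ∀ f, ι f =ᵐ[ν] holo f := by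
  obtain ⟨C, hC0, hC⟩ := h.exists_bound hα hβ hβ0
  have hm : ∀ f : Space α β 2, MemLp (holo f) 2 ν := fun f =>
    memLp_holo_of_lintegral hα hβ hβ0 hν (hC f)
  have hball := ae_mem_ball_of_measure_compl hν
  set L : Space α β 2 →ₗ[ℂ] Lp ℂ 2 ν :=
    { toFun := fun f => (hm f).toLp (holo f)
      map_add' := fun f g => by
        rw [← MemLp.toLp_add]
        refine MemLp.toLp_congr _ _ ?_
        filter_upwards [hball] with z hz
        exact holo_add hα hβ hβ0 f g (mem_ball_zero_iff.1 hz)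
      map_smul' := fun c f => by
        rw [RingHom.id_apply, ← MemLp.toLp_const_smul]
        refine MemLp.toLp_congr _ _ ?_
        filter_upwards [hball] with z hz
        exact holo_smul hα hβ hβ0 c f (mem_ball_zero_iff.1 hz) } with hL
  refine ⟨L.mkContinuous (√C) fun f => ?_, fun f => (hm f).coeFn_toLp⟩
  have h1 : ENNReal.ofReal (‖L f‖ ^ 2) ≤ ENNReal.ofReal (C * ‖f‖ ^ 2) := by
    rw [← lintegral_norm_sq_eq]
    refine le_trans (le_of_eq (lintegral_congr_ae ?_)) (hC f)
    filter_upwards [(hm f).coeFn_toLp] with w hw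
    exact congrArg (fun x : ℂ => ENNReal.ofReal (‖x‖ ^ 2)) hw
  rw [ENNReal.ofReal_le_ofReal_iff (by positivity)] at h1
  refine le_of_sq_le_sq ?_ (by positivity)
  rwa [mul_pow, Real.sq_sqrt hC0]

/-! ### Compactness of the embedding -/

lemma norm_monomial_le {α β : ℝ} (hα : -1 < α) (hβ : -1 < β) (n : ℕ) :
    ‖monomial hα hβ n‖ ≤ 1 := by
  have := isProbabilityMeasure_measure hα hβ
  change ‖(monomial hα hβ n : Lp ℂ 2 (measure α β))‖ ≤ 1
  refine (Lp.norm_le_of_ae_bound zero_le_one ?_).trans (by simp [measureUnivNNReal])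
  filter_upwards [ae_eq_holo (monomial hα hβ n), ae_mem_ball α β] with z hz hzb
  rw [hz, monomial, holo_ofHolo hα hβ _ _ hzb, norm_pow]
  exact pow_le_one₀ (norm_nonneg z) (mem_ball_zero_iff.1 hzb).le

/-- Functions that are orthogonal to the monomials of small degree are small on compact sets. -/
lemma norm_holo_le_tail {α β : ℝ} (hα : -1 < α) (hβ : -1 < β) (hβ0 : β ≤ 0) {N : ℕ}
    {g : Space α β 2} (hg : ∀ n < N, inner ℂ (monomial hα hβ n) g = 0) {r : ℝ} (hr : r < 1) {w : ℂ}
    (hw : ‖w‖ ≤ r) : ‖holo g w‖ ≤ (∑' n, (moment α β (n + N))⁻¹ * r ^ (n + N)) * ‖g‖ := by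
  obtain ⟨c, hc1, hc2⟩ := exists_coeff hα hβ hβ0 g
  have hr0 : 0 ≤ r := (norm_nonneg w).trans hw
  have hcm : ∀ n, c n * moment α β n = inner ℂ (monomial hα hβ n) g := fun n => by
    rw [inner_monomial, hc2]
  have hm0 : ∀ n, (moment α β n : ℂ) ≠ 0 := fun n => by
    exact_mod_cast (moment_pos hα hβ n).ne'
  have hc0 : ∀ n < N, c n = 0 := fun n hn =>
    (mul_eq_zero.1 ((hcm n).trans (hg n hn))).resolve_right (hm0 n)
  -- Cauchy–Schwarz for c_n · moment = ⟨g, z^n⟩, with ‖z^n‖ ≤ 1. The tail of the kernel series then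
  -- majorizes the Taylor series of g.
  have hcn : ∀ n, ‖c n‖ ≤ (moment α β n)⁻¹ * ‖g‖ := fun n => by
    have h1 : ‖c n‖ * moment α β n ≤ ‖g‖ := by
      have h2 : ‖c n * moment α β n‖ ≤ ‖monomial hα hβ n‖ * ‖g‖ := by
        rw [hcm]; exact norm_inner_le_norm (monomial hα hβ n) g
      rw [norm_mul, Complex.norm_real, Real.norm_of_nonneg (moment_pos hα hβ n).le] at h2
      exact h2.trans (mul_le_of_le_one_left (norm_nonneg g) (norm_monomial_le hα hβ n))
    rw [inv_mul_eq_div, le_div_iff₀ (moment_pos hα hβ n)]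
    exact h1
  have h1 := (hasSum_nat_add_iff' N).2 (hc1 w (mem_ball_zero_iff.2 (hw.trans_lt hr)))
  rw [Finset.sum_eq_zero fun n hn => by rw [hc0 n (Finset.mem_range.1 hn), zero_mul],
    sub_zero] at h1
  have h2 : Summable fun n => (moment α β (n + N))⁻¹ * r ^ (n + N) :=
    (summable_nat_add_iff N).2 (summable_inv_moment_mul_pow hα hβ hr0 hr)
  rw [← h1.tsum_eq]
  refine tsum_of_norm_bounded (h2.hasSum.mul_right ‖g‖) fun n => ?_
  rw [norm_mul, norm_pow, mul_right_comm]
  have := hcn (n + N)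
  have hm := inv_nonneg.2 (moment_pos hα hβ (n + N)).le
  gcongr

/-- Let P_N project onto the span of 1, ..., z^{N-1}. Then ι - ιP_N acts on f through g = f - P_N f,
which is at most t_N‖g‖ on |w| ≤ r with t_N → 0. Taking B = t_N‖g‖ in `SmallEmbedding` makes the
operator norm small, so ι is a norm limit of finite rank operators. -/
lemma SmallEmbedding.isCompactOperator {α β : ℝ} (hα : -1 < α) (hβ : -1 < β) (hβ0 : β ≤ 0)
    {ν : Measure ℂ} (h : SmallEmbedding α β ν)
    {ι : Space α β 2 →L[ℂ] Lp ℂ 2 ν} (hι : ∀ f, ι f =ᵐ[ν] holo f) : IsCompactOperator ι := by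
  set V : ℕ → Submodule ℂ (Space α β 2) := fun N =>
    Submodule.span ℂ (monomial hα hβ '' Set.Iio N) with hV
  have hfin : ∀ N, FiniteDimensional ℂ (V N) := fun N =>
    FiniteDimensional.span_of_finite ℂ ((Set.finite_Iio N).image _)
  have hcomp : ∀ N, IsCompactOperator (ι.comp (V N).starProjection) := fun N => by
    have : ProperSpace (V N) := FiniteDimensional.proper ℂ (V N)
    exact (isCompactOperator_of_locallyCompactSpace_dom
      (V N).orthogonalProjectionOnto).clm_comp (ι.comp (V N).subtypeL)
  refine isCompactOperator_of_tendsto (l := atTop)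
    (F := fun N => ι.comp (V N).starProjection) ?_ (Eventually.of_forall hcomp)
  refine (tendsto_iff_norm_sub_tendsto_zero (E := Space α β 2 →L[ℂ] Lp ℂ 2 ν)).2 ?_
  rw [Metric.tendsto_nhds]
  intro ε hε
  -- With ‖g‖ ≤ 2‖f‖ the two contributions of ε²/16 give 4(ε²/16 + ε²/16) = ε²/2 ≤ (3ε/4)², strictly
  -- inside the target ε.
  obtain ⟨r, hr, hf⟩ := h (ε ^ 2 / 16) (by positivity)
  set t : ℕ → ℝ := fun N => ∑' n, (moment α β (n + N))⁻¹ * r ^ (n + N) with ht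
  have htlim : Tendsto (fun N => t N ^ 2 * ν.real Set.univ) atTop (𝓝 0) := by
    have h1 : Tendsto t atTop (𝓝 0) := tendsto_sum_nat_add fun n => (moment α β n)⁻¹ * r ^ n
    simpa using (h1.pow 2).mul_const (ν.real Set.univ)
  filter_upwards [htlim.eventually (gt_mem_nhds (show 0 < ε ^ 2 / 16 by positivity))] with N hN
  rw [dist_zero_right, norm_norm]
  refine lt_of_le_of_lt (ContinuousLinearMap.opNorm_le_bound _ (M := 3 / 4 * ε) (by positivity)
    fun f => ?_) (by linarith)
  set g := f - (V N).starProjection f with hg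
  have hgn : ‖g‖ ≤ 2 * ‖f‖ := by
    have h1 := (V N).starProjection.le_of_opNorm_le (V N).starProjection_norm_le f
    have h2 := norm_sub_le f ((V N).starProjection f)
    linarith
  have horth : ∀ n < N, inner ℂ (monomial hα hβ n) g = 0 := fun n hn =>
    (Submodule.mem_orthogonal _ _).1 (Submodule.sub_starProjection_mem_orthogonal f) _
      (Submodule.subset_span ⟨n, hn, rfl⟩)
  have h1 := hf g (t N * ‖g‖) fun w hw => norm_holo_le_tail hα hβ hβ0 horth hr hw
  have h2 : ENNReal.ofReal (‖ι g‖ ^ 2) ≤ ENNReal.ofReal ((3 / 4 * ε * ‖f‖) ^ 2) := by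
    rw [← lintegral_norm_sq_eq]
    refine le_trans (le_of_eq (lintegral_congr_ae ?_)) (h1.trans (ENNReal.ofReal_le_ofReal ?_))
    · filter_upwards [hι g] with w hw
      rw [hw]
    · have h3 : ‖g‖ ^ 2 ≤ 4 * ‖f‖ ^ 2 := by nlinarith [norm_nonneg g]
      calc ε ^ 2 / 16 * ‖g‖ ^ 2 + (t N * ‖g‖) ^ 2 * ν.real Set.univ
          = (ε ^ 2 / 16 + t N ^ 2 * ν.real Set.univ) * ‖g‖ ^ 2 := by ring
        _ ≤ (ε ^ 2 / 16 + ε ^ 2 / 16) * (4 * ‖f‖ ^ 2) := by gcongr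
        _ ≤ _ := by nlinarith [mul_nonneg (sq_nonneg ε) (sq_nonneg ‖f‖)]
  rw [ENNReal.ofReal_le_ofReal_iff (by positivity)] at h2
  have h4 : (ι.comp (V N).starProjection - ι) f = -ι g := by
    rw [hg, map_sub, neg_sub]; rfl
  rw [h4, norm_neg]
  exact le_of_sq_le_sq h2 (by positivity)

/-! ### The Toeplitz operator of a vanishing Carleson measure -/

/-- The Toeplitz operator is `ι† ι`, where `ι` is the inclusion in `L²(ν)`. -/
lemma isToeplitz_adjoint_comp {α β : ℝ} (hα : -1 < α) (hβ : -1 < β) (hβ0 : β ≤ 0)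
    [CompleteSpace (Space α β 2)] {ν : Measure ℂ} (hν : ν (ball (0 : ℂ) 1)ᶜ = 0)
    {ι : Space α β 2 →L[ℂ] Lp ℂ 2 ν} (hι : ∀ f, ι f =ᵐ[ν] holo f) :
    IsToeplitz ν ((ContinuousLinearMap.adjoint ι).comp ι) := by
  intro f z hz
  have hz' := mem_ball_zero_iff.1 hz
  have hk : ι (kernelAt α β z) =ᵐ[ν] fun w => kernel α β w z := by
    filter_upwards [hι (kernelAt α β z), ae_mem_ball_of_measure_compl hν] with w hw hwb
    rw [hw, holo_kernelAt hα hβ hz' hwb]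
  have hmf : MemLp (holo f) 2 ν := (memLp_congr_ae (hι f)).1 (Lp.memLp _)
  have hmk : MemLp (fun w => kernel α β w z) 2 ν := (memLp_congr_ae hk).1 (Lp.memLp _)
  -- Absolute convergence, as a product of two functions in L²(ν). For the value at z, evaluation is
  -- pairing with K_z, and the adjoint moves this pairing to L²(ν).
  refine ⟨hmf.integrable_mul hmk.star, ?_⟩
  rw [← inner_kernelAt hα hβ hβ0 _ hz']
  refine (ContinuousLinearMap.adjoint_inner_right ι (kernelAt α β z) (ι f)).trans ?_
  rw [L2.inner_def, toeplitz]
  refine integral_congr_ae ?_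
  filter_upwards [hι f, hk] with w h1 h2
  rw [h1, h2, RCLike.inner_apply]

theorem IsVanishingCarleson.toeplitzCompact {α β : ℝ} (hα : -1 < α) (hβ : -1 < β) (hβ0 : β ≤ 0)
    {p : ℝ≥0∞} [hp1 : Fact (1 ≤ p)] (hp : p ≠ ∞) {ν : Measure ℂ}
    (hν : ν (ball (0 : ℂ) 1)ᶜ = 0) (h : IsVanishingCarleson α β p ν) : ToeplitzCompact α β ν := by
  have := completeSpace_space hα hβ hβ0
  obtain ⟨i, hi, -⟩ := id h
  have := isFiniteMeasure_of_isInclusion hα hβ hp hν hi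
  have hs := h.smallEmbedding hα hβ hβ0 hp hν
  obtain ⟨ι, hι⟩ := hs.exists_inclusion hα hβ hβ0 hν
  exact ⟨_, isToeplitz_adjoint_comp hα hβ hβ0 hν hι,
    (hs.isCompactOperator hα hβ hβ0 hι).clm_comp (ContinuousLinearMap.adjoint ι)⟩

end ModifiedBergman

theorem mainTheorem8 (α β : ℝ) (hα : -1 < α) (hβ : β ∈ ModifiedBergman.admissible α)
    (p : ℝ≥0∞) [Fact (1 ≤ p)] (hp : p ≠ ∞)
    (ν : Measure ℂ) (hν : ν (ball (0 : ℂ) 1)ᶜ = 0) :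
    (ModifiedBergman.IsVanishingCarleson α β p ν → ModifiedBergman.ToeplitzCompact α β ν) ∧
    (ModifiedBergman.ToeplitzCompact α β ν →
      (∀ z ∈ ball (0 : ℂ) 1, ModifiedBergman.berezin α β ν z =
        ((∫ w, ‖ModifiedBergman.normalizedKernel α β z w‖ ^ 2 ∂ν : ℝ) : ℂ)) ∧
      Tendsto (ModifiedBergman.berezin α β ν) (comap (fun z : ℂ => ‖z‖) (𝓝[<] 1)) (𝓝 0)) := by
  obtain ⟨hβ1, hβ0, -⟩ := hβ
  exact ⟨fun h => h.toeplitzCompact hα hβ1 hβ0 hp hν,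
    fun h => ModifiedBergman.berezin_of_toeplitzCompact hα hβ1 hβ0 hν h⟩
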